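/- Let $\Omega$ be a compact metric space with its Borel $\sigma$-algebra and a probability measure $\mathbf P$, and let $\tau_y:\Omega\to\Omega$, $y\in\mathbb R^d$, be a group of continuous maps ($\tau_0=\mathrm{Id}$, $\tau_{x+y}=\tau_x\circ\tau_y$) that preserve $\mathbf P$, with $(y,\omega)\mapsto\tau_y\omega$ measurable, and ergodic (every measurable $\tau$-invariant function is a.s. constant). Let $\mathbf M$ be the space of symmetric $d\times d$ matrices with the Frobenius inner product $\xi\cdot\eta=\sum_{i,j}\xi_{ij}\eta_{ij}$ and its norm $|\cdot|$. Let $p$ be a random variable with $1<\alpha\le p(\omega)\le\beta<\infty$ and let $p'=p/(p-1)$. Let $\mathbf A:\Omega\times\mathbf M\to\mathbf M$ satisfy: * $\mathbf A(\cdot,\xi)$ is measurable for every $\xi$, and $\mathbf A(\omega,\cdot)$ is continuous for a.e. $\omega$; * $(\mathbf A(\omega,\xi_1)-\mathbf A(\omega,\xi_2))\cdot(\xi_1-\xi_2)>0$ for all $\omega$ and all $\xi_1\ne\xi_2$; * there is $\kappa_0>0$ with $\mathbf A(\omega,\xi)\cdot\xi\ge \kappa_0|\xi|^{p(\omega)}-\kappa_0^{-1}$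 for all $\omega,\xi$; * there is $\kappa_1>0$ with $|\mathbf A(\omega,\xi)|^{p'(\omega)}\le \kappa_1|\xi|^{p(\omega)}+\kappa_1$ for all $\omega,\xi$. For a variable exponent $q$, let $L^{q(\cdot)}(\Omega;\mathbf M)$ be the space of (classes of) measurable $\phi:\Omega\to\mathbf M$ with $\int_\Omega|\phi|^{q(\omega)}\,d\mathbf P<\infty$, with the Luxemburg norm $\inf\{\lambda>0:\int_\Omega|\lambda^{-1}\phi|^{q(\omega)}d\mathbf P\le1\}$. Let $\partial_i$ be the generator in $L^2(\Omega)$ of $\phi\mapsto\phi\circ\tau_{te_i}$, $t\in\mathbb R$, and let $\mathcal D^\infty$ be the set of $\phi\in L^\infty(\Omega)$ all of whose iterated derivatives $\partial_{i_1}\cdots\partial_{i_k}\phi$ exist in $L^2(\Omega)$. Let $\mathcal G(\Omega)$ be the closure in $L^{p(\cdot)}(\Omega;\mathbf M)$ of the fields $D_\omega\phi=\big(\tfrac12(\partial_i\phi_j+\partial_j\phi_i)\big)_{ij}$ with $\phi\in(\mathcal D^\infty)^d$ and $\sum_i\partial_i\phi_i=0$, and let $$\mathcal G^\perp(\Omega)=\Big\{\theta\in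 L^{p'(\cdot)}(\Omega;\mathbf M):\int_\Omega\theta\cdot v\,d\mathbf P=0\ \text{ for all }v\in\mathcal G(\Omega)\Big\}.$$ For $\xi,\eta\in\mathbf M$ set $$f(\xi)=\inf_{v\in\mathcal G(\Omega)}\int_\Omega\frac{|\xi+v|^{p(\omega)}}{p(\omega)}\,d\mathbf P,\qquad f^*(\eta)=\inf\Big\{\int_\Omega\frac{|w|^{p'(\omega)}}{p'(\omega)}\,d\mathbf P:\ w\in\mathcal G^\perp(\Omega),\ \int_\Omega w\,d\mathbf P=\eta\Big\}.$$ Then for every $\xi\in\mathbf M$ there is a unique $v_\xi\in\mathcal G(\Omega)$ with $\int_\Omega\mathbf A(\omega,\xi+v_\xi)\cdot\theta\,d\mathbf P=0$ for all $\theta\in\mathcal G(\Omega)$, and the homogenized tensor $$A^{\rm eff}(\xi)=\int_\Omega\mathbf A(\omega,\xi+v_\xi(\omega))\,d\mathbf P$$ has the following properties. 1. $A^{\rm eff}$ is strictly monotone: $(A^{\rm eff}(\xi_1)-A^{\rm eff}(\xi_2))\cdot(\xi_1-\xi_2)>0$ for all $\xi_1\ne\xi_2$. 2. $A^{\rm eff}:\mathbf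 M\to\mathbf M$ is continuous. 3. For every $\xi$ the flux $\mathbf A(\cdot,\xi+v_\xi(\cdot))$ belongs to $L^{p'(\cdot)}(\Omega;\mathbf M)$, and $\xi\mapsto\mathbf A(\cdot,\xi+v_\xi(\cdot))$ is continuous from $\mathbf M$ to $L^{p'(\cdot)}(\Omega;\mathbf M)$ with its weak topology. 4. There are $c_0>0$ and $c_1>0$ such that for all $\xi\in\mathbf M$ $$A^{\rm eff}(\xi)\cdot\xi\ge c_0f(\xi)-c_0^{-1},\qquad f^*\big(A^{\rm eff}(\xi)\big)\le c_1f(\xi)+c_1.$$ -/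

import Mathlib

open MeasureTheory Filter Topology
open scoped ENNReal

noncomputable section

/-! ### Symmetric matrices -/

/-- Symmetric `d × d` matrices, as a subspace of all matrices with the Euclidean (Frobenius)
inner product `∑ i j, ξ i j * η i j`. -/
def symSubmodule (d : ℕ) : Submodule ℝ (EuclideanSpace ℝ (Fin d × Fin d)) where
  carrier := {ξ | ∀ i j, ξ (i, j) = ξ (j, i)}
  add_mem' := by
    intro a b ha hb i j
    simp [ha i j, hb i j]
  zero_mem' := by
    intro i j
    simp
  smul_mem' := by
    intro c a ha i j
    simp [ha i j]

/-- The Euclidean space of symmetric `d × d` matrices. -/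
abbrev SymMat (d : ℕ) : Type := ↥(symSubmodule d)

/-- The symmetric part of the matrix `M`. -/
def symPart {d : ℕ} (M : Fin d → Fin d → ℝ) : SymMat d :=
  ⟨WithLp.toLp 2 fun ij => (M ij.1 ij.2 + M ij.2 ij.1) / 2, by
    intro i j
    simp [add_comm]⟩

/-! ### Lebesgue spaces with variable exponent -/

/-- A variable exponent: a random variable `p` with `1 < α ≤ p ≤ β < ∞`. -/
structure VariableExponent {Ω : Type*} [MeasurableSpace Ω] (P : Measure Ω) where
  toFun : Ω → ℝ
  α : ℝ
  β : ℝ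
  aemeasurable' : AEMeasurable toFun P
  one_lt_α : 1 < α
  α_le_β : α ≤ β
  α_le : ∀ ω, α ≤ toFun ω
  le_β : ∀ ω, toFun ω ≤ β

namespace VariableExponent

variable {Ω : Type*} [MeasurableSpace Ω] {P : Measure Ω}

instance : CoeFun (VariableExponent P) (fun _ => Ω → ℝ) := ⟨VariableExponent.toFun⟩

theorem aemeasurable (p : VariableExponent P) : AEMeasurable (fun ω => p ω) P := p.aemeasurable'

theorem one_lt (p : VariableExponent P) (ω : Ω) : 1 < p ω := p.one_lt_α.trans_le (p.α_le ω)

/-- The conjugate exponent `p' = p / (p - 1)`. -/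
def conj (p : VariableExponent P) : VariableExponent P where
  toFun ω := p ω / (p ω - 1)
  α := p.β / (p.β - 1)
  β := p.α / (p.α - 1)
  aemeasurable' := p.aemeasurable.div (p.aemeasurable.sub_const 1)
  one_lt_α := by
    have h1 := p.one_lt_α
    have h2 := p.α_le_β
    rw [lt_div_iff₀ (by linarith)]
    linarith
  α_le_β := by
    have h1 := p.one_lt_α
    have h2 := p.α_le_β
    rw [div_le_div_iff₀ (by linarith) (by linarith)]
    nlinarith
  α_le ω := by
    have h1 := p.one_lt ω
    have h2 := p.le_β ω
    rw [div_le_div_iff₀ (by linarith) (by linarith)]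
    nlinarith
  le_β ω := by
    have h1 := p.one_lt_α
    have h2 := p.α_le ω
    rw [div_le_div_iff₀ (by linarith) (by linarith)]
    nlinarith

end VariableExponent

section VarLp

variable {Ω : Type*} [MeasurableSpace Ω] {P : Measure Ω}
variable (E : Type*) [NormedAddCommGroup E] [NormedSpace ℝ E]

/-- The (classes of) functions `φ` with `∫ |φ|^p dP < ∞`. -/
def varLpSubmodule (p : VariableExponent P) : Submodule ℝ (Ω →ₘ[P] E) where
  carrier := {φ | ∫⁻ ω, ‖φ ω‖ₑ ^ p ω ∂P < ∞}
  zero_mem' := by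
    have h : ∫⁻ ω, ‖(0 : Ω →ₘ[P] E) ω‖ₑ ^ p ω ∂P = 0 := by
      refine (lintegral_congr_ae (g := fun _ => 0) ?_).trans lintegral_zero
      filter_upwards [AEEqFun.coeFn_zero (α := Ω) (μ := P) (β := E)] with ω hω
      have h1 := p.one_lt ω
      rw [hω]
      simp [ENNReal.zero_rpow_of_pos (show 0 < p ω by linarith)]
    show ∫⁻ ω, ‖(0 : Ω →ₘ[P] E) ω‖ₑ ^ p ω ∂P < ∞
    rw [h]
    exact ENNReal.zero_lt_top
  add_mem' := by
    intro a b ha hb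
    have hm : AEMeasurable (fun ω => ‖a ω‖ₑ ^ p ω) P :=
      a.aestronglyMeasurable.enorm.pow p.aemeasurable
    have hle : ∫⁻ ω, ‖(a + b) ω‖ₑ ^ p ω ∂P ≤
        ∫⁻ ω, (2 : ℝ≥0∞) ^ (p.β - 1) * (‖a ω‖ₑ ^ p ω + ‖b ω‖ₑ ^ p ω) ∂P := by
      refine lintegral_mono_ae ?_
      filter_upwards [AEEqFun.coeFn_add a b] with ω hω
      have h1 := p.one_lt ω
      rw [hω]
      calc ‖(a : Ω → E) ω + b ω‖ₑ ^ p ω ≤ (‖a ω‖ₑ + ‖b ω‖ₑ) ^ p ω :=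
            ENNReal.rpow_le_rpow (enorm_add_le _ _) (by linarith)
        _ ≤ (2 : ℝ≥0∞) ^ (p ω - 1) * (‖a ω‖ₑ ^ p ω + ‖b ω‖ₑ ^ p ω) :=
            ENNReal.rpow_add_le_mul_rpow_add_rpow _ _ h1.le
        _ ≤ _ := by
            gcongr
            · norm_num
            · exact p.le_β ω
    refine hle.trans_lt ?_
    have hc : (2 : ℝ≥0∞) ^ (p.β - 1) ≠ ∞ :=
      ENNReal.rpow_ne_top_of_nonneg (by linarith [p.one_lt_α, p.α_le_β]) (by norm_num)
    rw [lintegral_const_mul' _ _ hc, lintegral_add_left' hm]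
    exact ENNReal.mul_lt_top hc.lt_top (ENNReal.add_lt_top.2 ⟨ha, hb⟩)
  smul_mem' := by
    intro c a ha
    have hle : ∫⁻ ω, ‖(c • a) ω‖ₑ ^ p ω ∂P ≤
        ∫⁻ ω, (max 1 ‖c‖ₑ) ^ p.β * ‖a ω‖ₑ ^ p ω ∂P := by
      refine lintegral_mono_ae ?_
      filter_upwards [AEEqFun.coeFn_smul c a] with ω hω
      have h1 := p.one_lt ω
      rw [hω, Pi.smul_apply, enorm_smul, ENNReal.mul_rpow_of_nonneg _ _ (by linarith)]
      gcongr
      calc ‖c‖ₑ ^ p ω ≤ (max 1 ‖c‖ₑ) ^ p ω :=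
            ENNReal.rpow_le_rpow (le_max_right _ _) (by linarith)
        _ ≤ _ := ENNReal.rpow_le_rpow_of_exponent_le (le_max_left _ _) (p.le_β ω)
    refine hle.trans_lt ?_
    have hc : (max 1 ‖c‖ₑ) ^ p.β ≠ ∞ :=
      ENNReal.rpow_ne_top_of_nonneg (by linarith [p.one_lt_α, p.α_le_β]) (by simp)
    rw [lintegral_const_mul' _ _ hc]
    exact ENNReal.mul_lt_top hc.lt_top ha

/-- The space `L^{p(·)}(Ω, E)`. -/
def VarLp (p : VariableExponent P) : Type _ := ↥(varLpSubmodule E p)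

namespace VarLp

variable {E}
variable {p : VariableExponent P}

instance : AddCommGroup (VarLp E p) := inferInstanceAs (AddCommGroup ↥(varLpSubmodule E p))

instance : Module ℝ (VarLp E p) := inferInstanceAs (Module ℝ ↥(varLpSubmodule E p))

/-- The underlying class of functions modulo equality almost everywhere. -/
def toAEEqFun (φ : VarLp E p) : Ω →ₘ[P] E := φ.1

instance : CoeFun (VarLp E p) (fun _ => Ω → E) := ⟨fun φ => φ.toAEEqFun⟩

/-- The Luxemburg norm `inf {l > 0 : ∫ |φ / l|^p dP ≤ 1}`. -/
instance : Norm (VarLp E p) :=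
  ⟨fun φ => sInf {l : ℝ | 0 < l ∧ ∫⁻ ω, (‖φ ω‖ₑ / ENNReal.ofReal l) ^ p ω ∂P ≤ 1}⟩

theorem norm_def (φ : VarLp E p) :
    ‖φ‖ = sInf {l : ℝ | 0 < l ∧ ∫⁻ ω, (‖φ ω‖ₑ / ENNReal.ofReal l) ^ p ω ∂P ≤ 1} := rfl

theorem coeFn_add (φ ψ : VarLp E p) : ∀ᵐ ω ∂P, (φ + ψ) ω = φ ω + ψ ω :=
  AEEqFun.coeFn_add φ.1 ψ.1

theorem coeFn_smul (c : ℝ) (φ : VarLp E p) : ∀ᵐ ω ∂P, (c • φ) ω = c • φ ω :=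
  AEEqFun.coeFn_smul c φ.1

theorem mul_rpow_le {s x : ℝ≥0∞} (hs : s ≤ 1) {q : ℝ} (hq : 1 ≤ q) :
    (s * x) ^ q ≤ s * x ^ q := by
  rw [ENNReal.mul_rpow_of_nonneg _ _ (by linarith)]
  gcongr
  calc s ^ q ≤ s ^ (1 : ℝ) := ENNReal.rpow_le_rpow_of_exponent_ge hs hq
    _ = s := ENNReal.rpow_one s

theorem bddBelow_set (φ : VarLp E p) :
    BddBelow {l : ℝ | 0 < l ∧ ∫⁻ ω, (‖φ ω‖ₑ / ENNReal.ofReal l) ^ p ω ∂P ≤ 1} :=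
  ⟨0, fun _ h => h.1.le⟩

theorem nonempty_set (φ : VarLp E p) :
    {l : ℝ | 0 < l ∧ ∫⁻ ω, (‖φ ω‖ₑ / ENNReal.ofReal l) ^ p ω ∂P ≤ 1}.Nonempty := by
  have hfin : ∫⁻ ω, ‖φ ω‖ₑ ^ p ω ∂P < ∞ := φ.2
  set r := ∫⁻ ω, ‖φ ω‖ₑ ^ p ω ∂P with hr
  set l : ℝ := max 1 r.toReal with hl
  have hl1 : 1 ≤ l := le_max_left _ _
  have hL1 : 1 ≤ ENNReal.ofReal l := by simpa using hl1
  have hL0 : ENNReal.ofReal l ≠ 0 := (zero_lt_one.trans_le hL1).ne'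
  have hinv : (ENNReal.ofReal l)⁻¹ ≤ 1 := ENNReal.inv_le_one.2 hL1
  refine ⟨l, by linarith, ?_⟩
  calc ∫⁻ ω, (‖φ ω‖ₑ / ENNReal.ofReal l) ^ p ω ∂P
      ≤ ∫⁻ ω, (ENNReal.ofReal l)⁻¹ * ‖φ ω‖ₑ ^ p ω ∂P := by
        refine lintegral_mono fun ω => ?_
        rw [div_eq_mul_inv, mul_comm]
        exact mul_rpow_le hinv (p.one_lt ω).le
    _ = (ENNReal.ofReal l)⁻¹ * r := lintegral_const_mul' _ _ (ENNReal.inv_ne_top.2 hL0)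
    _ ≤ (ENNReal.ofReal l)⁻¹ * ENNReal.ofReal l := by
        gcongr
        exact ENNReal.le_ofReal_iff_toReal_le hfin.ne (by linarith) |>.2 (le_max_right _ _)
    _ = 1 := ENNReal.inv_mul_cancel hL0 ENNReal.ofReal_ne_top

theorem norm_smul_le' (c : ℝ) (φ : VarLp E p) : ‖c • φ‖ ≤ |c| * ‖φ‖ := by
  rcases eq_or_ne c 0 with rfl | hc
  · have h0 : ∀ l : ℝ, 0 < l → ‖(0 : ℝ) • φ‖ ≤ l := by
      intro l hl
      refine csInf_le (bddBelow_set _) ⟨hl, ?_⟩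
      have : ∫⁻ ω, (‖((0 : ℝ) • φ) ω‖ₑ / ENNReal.ofReal l) ^ p ω ∂P = 0 := by
        refine (lintegral_congr_ae (g := fun _ => 0) ?_).trans lintegral_zero
        filter_upwards [coeFn_smul 0 φ] with ω hω
        have h1 := p.one_lt ω
        rw [hω]
        simp [ENNReal.zero_rpow_of_pos (show 0 < p ω by linarith)]
      rw [this]
      exact zero_le_one
    simpa using le_of_forall_gt_imp_ge_of_dense h0
  · have hc' : 0 < |c| := abs_pos.2 hc
    rw [mul_comm, ← div_le_iff₀ hc', norm_def φ]
    refine le_csInf (nonempty_set φ) ?_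
    rintro l ⟨hl, hle⟩
    rw [div_le_iff₀ hc', mul_comm]
    refine csInf_le (bddBelow_set _) ⟨mul_pos hc' hl, ?_⟩
    refine le_trans (le_of_eq (lintegral_congr_ae ?_)) hle
    filter_upwards [coeFn_smul c φ] with ω hω
    have hce : ‖c‖ₑ = ENNReal.ofReal |c| := by
      rw [← ofReal_norm, Real.norm_eq_abs]
    rw [hω, enorm_smul, hce, ENNReal.ofReal_mul hc'.le,
      ENNReal.mul_div_mul_left _ _ (by simpa using hc) ENNReal.ofReal_ne_top]

theorem norm_add_le' (φ ψ : VarLp E p) : ‖φ + ψ‖ ≤ ‖φ‖ + ‖ψ‖ := by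
  have key : ∀ l m : ℝ, (0 < l ∧ ∫⁻ ω, (‖φ ω‖ₑ / ENNReal.ofReal l) ^ p ω ∂P ≤ 1) →
      (0 < m ∧ ∫⁻ ω, (‖ψ ω‖ₑ / ENNReal.ofReal m) ^ p ω ∂P ≤ 1) → ‖φ + ψ‖ ≤ l + m := by
    rintro l m ⟨hl, hle⟩ ⟨hm, hme⟩
    have hlm : 0 < l + m := by linarith
    refine csInf_le (bddBelow_set _) ⟨hlm, ?_⟩
    set L := ENNReal.ofReal l with hL
    set M := ENNReal.ofReal m with hM
    have hL0 : L ≠ 0 := by simpa [hL] using hl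
    have hM0 : M ≠ 0 := by simpa [hM] using hm
    have hLt : L ≠ ∞ := ENNReal.ofReal_ne_top
    have hMt : M ≠ ∞ := ENNReal.ofReal_ne_top
    have hLM : ENNReal.ofReal (l + m) = L + M := ENNReal.ofReal_add hl.le hm.le
    have hS0 : L + M ≠ 0 := by simp [hL0]
    have hSt : L + M ≠ ∞ := by simp [hLt, hMt]
    have hsum : L / (L + M) + M / (L + M) = 1 := by
      rw [← ENNReal.add_div, ENNReal.div_self hS0 hSt]
    have hst : L / (L + M) ≠ ∞ := ENNReal.div_ne_top hLt hS0
    have htt : M / (L + M) ≠ ∞ := ENNReal.div_ne_top hMt hS0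
    have hmeas : AEMeasurable (fun ω => L / (L + M) * (‖φ ω‖ₑ / L) ^ p ω) P :=
      ((φ.1.aestronglyMeasurable.enorm.div_const L).pow p.aemeasurable).const_mul _
    calc ∫⁻ ω, (‖(φ + ψ) ω‖ₑ / ENNReal.ofReal (l + m)) ^ p ω ∂P
        ≤ ∫⁻ ω, (L / (L + M) * (‖φ ω‖ₑ / L) ^ p ω + M / (L + M) * (‖ψ ω‖ₑ / M) ^ p ω) ∂P := by
          refine lintegral_mono_ae ?_
          filter_upwards [coeFn_add φ ψ] with ω hω
          have h1 := p.one_lt ω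
          rw [hω, hLM]
          refine le_trans (ENNReal.rpow_le_rpow ?_ (by linarith))
            (ENNReal.rpow_arith_mean_le_arith_mean2_rpow _ _ _ _ hsum h1.le)
          have e1 : L / (L + M) * (‖φ ω‖ₑ / L) = ‖φ ω‖ₑ / (L + M) := by
            rw [mul_comm, ← mul_div_assoc, ENNReal.div_mul_cancel hL0 hLt]
          have e2 : M / (L + M) * (‖ψ ω‖ₑ / M) = ‖ψ ω‖ₑ / (L + M) := by
            rw [mul_comm, ← mul_div_assoc, ENNReal.div_mul_cancel hM0 hMt]
          rw [e1, e2, ← ENNReal.add_div]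
          gcongr
          exact enorm_add_le _ _
      _ = L / (L + M) * ∫⁻ ω, (‖φ ω‖ₑ / L) ^ p ω ∂P +
          M / (L + M) * ∫⁻ ω, (‖ψ ω‖ₑ / M) ^ p ω ∂P := by
          rw [lintegral_add_left' hmeas, lintegral_const_mul' _ _ hst,
            lintegral_const_mul' _ _ htt]
      _ ≤ L / (L + M) * 1 + M / (L + M) * 1 := by gcongr
      _ = 1 := by rw [mul_one, mul_one, hsum]
  have h1 : ∀ m : ℝ, (0 < m ∧ ∫⁻ ω, (‖ψ ω‖ₑ / ENNReal.ofReal m) ^ p ω ∂P ≤ 1) →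
      ‖φ + ψ‖ - m ≤ ‖φ‖ := fun m hm =>
    le_csInf (nonempty_set φ) fun l hl => by linarith [key l m hl hm]
  have h2 : ‖φ + ψ‖ - ‖φ‖ ≤ ‖ψ‖ :=
    le_csInf (nonempty_set ψ) fun m hm => by linarith [h1 m hm]
  linarith

theorem eq_zero_of_norm (φ : VarLp E p) (h : ‖φ‖ = 0) : φ = 0 := by
  have key : ∀ s : ℝ, 0 < s → s ≤ 1 → ∫⁻ ω, ‖φ ω‖ₑ ^ p ω ∂P ≤ ENNReal.ofReal s := by
    intro s hs hs1
    have hlt : sInf {l : ℝ | 0 < l ∧ ∫⁻ ω, (‖φ ω‖ₑ / ENNReal.ofReal l) ^ p ω ∂P ≤ 1} < s := by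
      rw [← norm_def, h]
      exact hs
    obtain ⟨l, ⟨hl, hle⟩, hls⟩ := exists_lt_of_csInf_lt (nonempty_set φ) hlt
    have hL0 : ENNReal.ofReal l ≠ 0 := by simpa using hl
    have hL1 : ENNReal.ofReal l ≤ 1 := by
      simpa using hls.le.trans hs1
    calc ∫⁻ ω, ‖φ ω‖ₑ ^ p ω ∂P
        ≤ ∫⁻ ω, ENNReal.ofReal l * (‖φ ω‖ₑ / ENNReal.ofReal l) ^ p ω ∂P := by
          refine lintegral_mono fun ω => ?_
          refine le_trans (le_of_eq ?_) (mul_rpow_le hL1 (p.one_lt ω).le)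
          rw [ENNReal.mul_div_cancel hL0 ENNReal.ofReal_ne_top]
      _ = ENNReal.ofReal l * ∫⁻ ω, (‖φ ω‖ₑ / ENNReal.ofReal l) ^ p ω ∂P :=
          lintegral_const_mul' _ _ ENNReal.ofReal_ne_top
      _ ≤ ENNReal.ofReal l * 1 := by gcongr
      _ ≤ ENNReal.ofReal s := by
          rw [mul_one]
          exact ENNReal.ofReal_le_ofReal hls.le
  have hzero : ∫⁻ ω, ‖φ ω‖ₑ ^ p ω ∂P = 0 := by
    by_contra hne
    obtain ⟨s, hs0, hs⟩ := ENNReal.lt_iff_exists_nnreal_btwn.1 (pos_iff_ne_zero.2 hne)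
    have hs0' : (0 : ℝ) < s := by exact_mod_cast hs0
    have hle := key (min s 1) (lt_min hs0' one_pos) (min_le_right _ _)
    have hle' : ENNReal.ofReal (min (s : ℝ) 1) ≤ (s : ℝ≥0∞) := by
      refine (ENNReal.ofReal_le_ofReal (min_le_left _ _)).trans ?_
      simp
    exact absurd (hle.trans hle') (not_le.2 hs)
  have hm : AEMeasurable (fun ω => ‖φ ω‖ₑ ^ p ω) P :=
    φ.1.aestronglyMeasurable.enorm.pow p.aemeasurable
  have hae := (lintegral_eq_zero_iff' hm).1 hzero
  refine Subtype.ext (AEEqFun.ext ?_)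
  refine EventuallyEq.trans ?_ (AEEqFun.coeFn_zero (α := Ω) (μ := P) (β := E)).symm
  filter_upwards [hae] with ω hω
  have h1 := p.one_lt ω
  have h3 : ‖φ ω‖ₑ = 0 := by
    simpa [ENNReal.rpow_eq_zero_iff_of_pos (show 0 < p ω by linarith)] using hω
  exact enorm_eq_zero.1 h3

theorem normedSpaceCore : NormedSpace.Core ℝ (VarLp E p) where
  norm_nonneg _ := Real.sInf_nonneg fun _ h => h.1.le
  norm_smul c φ := by
    refine le_antisymm (by simpa using norm_smul_le' c φ) ?_
    rcases eq_or_ne c 0 with rfl | hc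
    · have : 0 ≤ ‖(0 : ℝ) • φ‖ := Real.sInf_nonneg fun _ h => h.1.le
      simpa using this
    · have h := norm_smul_le' c⁻¹ (c • φ)
      rw [smul_smul, inv_mul_cancel₀ hc, one_smul, abs_inv] at h
      rw [Real.norm_eq_abs]
      have hc' : 0 < |c| := abs_pos.2 hc
      calc |c| * ‖φ‖ ≤ |c| * (|c|⁻¹ * ‖c • φ‖) := by gcongr
        _ = ‖c • φ‖ := by field_simp
  norm_triangle := norm_add_le'
  norm_eq_zero_iff φ := by
    refine ⟨eq_zero_of_norm φ, ?_⟩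
    rintro rfl
    have h := norm_smul_le' 0 (0 : VarLp E p)
    have h0 : 0 ≤ ‖(0 : VarLp E p)‖ := Real.sInf_nonneg fun _ h => h.1.le
    simp only [smul_zero, abs_zero, zero_mul] at h
    exact le_antisymm h h0

instance : NormedAddCommGroup (VarLp E p) := NormedAddCommGroup.ofCore normedSpaceCore

instance : NormedSpace ℝ (VarLp E p) := NormedSpace.ofCore normedSpaceCore

end VarLp

end VarLp

/-! ### The dynamical system and its generators -/

section Homogenization

variable {Ω : Type*} [MeasurableSpace Ω] {d : ℕ}

/-- `τ` is a measurable, measure preserving, ergodic action of `ℝ^d` on the probability space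
`(Ω, P)`, each `τ_y` being continuous. -/
structure IsErgodicDynamicalSystem [TopologicalSpace Ω] (P : Measure Ω)
    (τ : EuclideanSpace ℝ (Fin d) → Ω → Ω) : Prop where
  map_zero : τ 0 = id
  map_add : ∀ x y, τ (x + y) = τ x ∘ τ y
  measurePreserving : ∀ y, MeasurePreserving (τ y) P P
  measurable : Measurable fun q : EuclideanSpace ℝ (Fin d) × Ω => τ q.1 q.2
  continuous : ∀ y, Continuous (τ y)
  ergodic : ∀ g : Ω → ℝ, Measurable g → (∀ y ω, g (τ y ω) = g ω) → ∃ c : ℝ, ∀ᵐ ω ∂P, g ω = c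

/-- `φ` is in the domain of the generator `∂_i` of `τ` in the `i`-th coordinate direction in
`L²(Ω)` and `∂_i φ = ψ`: the quotients `(φ ∘ τ_{t e_i} - φ) / t` tend to `ψ` in `L²(Ω)`. -/
def HasGeneratorDeriv (P : Measure Ω) (τ : EuclideanSpace ℝ (Fin d) → Ω → Ω) (i : Fin d)
    (φ ψ : Lp ℝ 2 P) : Prop :=
  Tendsto (fun t : ℝ => eLpNorm
      (fun ω => t⁻¹ * (φ (τ (EuclideanSpace.single i t) ω) - φ ω) - ψ ω) 2 P)
    (𝓝[≠] 0) (𝓝 0)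

/-- All derivatives `∂_{i_1} ⋯ ∂_{i_k} φ` with `k ≤ n` exist in `L²(Ω)`. -/
def HasDerivsUpTo (P : Measure Ω) (τ : EuclideanSpace ℝ (Fin d) → Ω → Ω) :
    ℕ → Lp ℝ 2 P → Prop
  | 0, _ => True
  | n + 1, φ => ∀ i, ∃ ψ, HasGeneratorDeriv P τ i φ ψ ∧ HasDerivsUpTo P τ n ψ

/-- The space `𝒟^∞` of essentially bounded functions with derivatives of all orders
in `L²(Ω)`. -/
def smoothFunctions (P : Measure Ω) (τ : EuclideanSpace ℝ (Fin d) → Ω → Ω) :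
    Set (Lp ℝ 2 P) :=
  {φ | MemLp φ ∞ P ∧ ∀ n, HasDerivsUpTo P τ n φ}

variable {P : Measure Ω}

/-- The symmetrized gradients `(D_ω φ)_{ij} = (∂_i φ_j + ∂_j φ_i) / 2` of the solenoidal
`φ ∈ (𝒟^∞)^d`; here `D i j = ∂_i φ_j`. -/
def solenoidalStrains (τ : EuclideanSpace ℝ (Fin d) → Ω → Ω) (p : VariableExponent P) :
    Set (VarLp (SymMat d) p) :=
  {g | ∃ (φ : Fin d → Lp ℝ 2 P) (D : Fin d → Fin d → Lp ℝ 2 P),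
    (∀ j, φ j ∈ smoothFunctions P τ) ∧
    (∀ i j, HasGeneratorDeriv P τ i (φ j) (D i j)) ∧
    ∑ i, D i i = 0 ∧
    ∀ᵐ ω ∂P, g ω = symPart fun i j => D i j ω}

/-- The space `𝒢(Ω)`, the closure of the solenoidal strains in `L^{p(·)}(Ω)`. -/
def strainSpace (τ : EuclideanSpace ℝ (Fin d) → Ω → Ω) (p : VariableExponent P) :
    Set (VarLp (SymMat d) p) :=
  closure (solenoidalStrains τ p)

/-- The annihilator `𝒢^⊥(Ω)` of `𝒢(Ω)` in `L^{p'(·)}(Ω)`. -/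
def strainSpacePerp (τ : EuclideanSpace ℝ (Fin d) → Ω → Ω) (p : VariableExponent P) :
    Set (VarLp (SymMat d) p.conj) :=
  {θ | ∀ v ∈ strainSpace τ p, ∫ ω, inner ℝ (θ ω) (v ω) ∂P = 0}

/-! ### The nonlinear tensor, the cell problem and the homogenized tensor -/

/-- The standing hypotheses on the random tensor `A`: it is a Carathéodory function, strictly
monotone, coercive, and of `p(·)`-growth. -/
structure IsAdmissible (p : VariableExponent P) (A : Ω → SymMat d → SymMat d) : Prop where
  aestronglyMeasurable : ∀ ξ, AEStronglyMeasurable (fun ω => A ω ξ) P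
  continuous : ∀ᵐ ω ∂P, Continuous (A ω)
  strictMono : ∀ ω ξ₁ ξ₂, ξ₁ ≠ ξ₂ → 0 < inner ℝ (A ω ξ₁ - A ω ξ₂) (ξ₁ - ξ₂)
  coercive : ∃ c₀ : ℝ, 0 < c₀ ∧ ∀ ω ξ, c₀ * ‖ξ‖ ^ p ω - c₀⁻¹ ≤ inner ℝ (A ω ξ) ξ
  growth : ∃ c₁ : ℝ, 0 < c₁ ∧ ∀ ω ξ, ‖A ω ξ‖ ^ p.conj ω ≤ c₁ * ‖ξ‖ ^ p ω + c₁

/-- `v ∈ 𝒢(Ω)` solves the cell problem `∫ A(ω, ξ + v) · θ dP = 0` for all `θ ∈ 𝒢(Ω)`. -/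
def IsCellSolution (τ : EuclideanSpace ℝ (Fin d) → Ω → Ω) (p : VariableExponent P)
    (A : Ω → SymMat d → SymMat d) (ξ : SymMat d) (v : VarLp (SymMat d) p) : Prop :=
  v ∈ strainSpace τ p ∧
    ∀ θ ∈ strainSpace τ p, ∫ ω, inner ℝ (A ω (ξ + v ω)) (θ ω) ∂P = 0

/-- The solution `v_ξ` of the cell problem. -/
def cellSolution (τ : EuclideanSpace ℝ (Fin d) → Ω → Ω) (p : VariableExponent P)
    (A : Ω → SymMat d → SymMat d) (ξ : SymMat d) : VarLp (SymMat d) p :=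
  Classical.epsilon (IsCellSolution τ p A ξ)

/-- The flux `ω ↦ A(ω, ξ + v_ξ(ω))`. -/
def flux (τ : EuclideanSpace ℝ (Fin d) → Ω → Ω) (p : VariableExponent P)
    (A : Ω → SymMat d → SymMat d) (ξ : SymMat d) (ω : Ω) : SymMat d :=
  A ω (ξ + cellSolution τ p A ξ ω)

/-- The homogenized tensor `A^eff(ξ) = ∫ A(ω, ξ + v_ξ(ω)) dP`. -/
def Aeff (τ : EuclideanSpace ℝ (Fin d) → Ω → Ω) (p : VariableExponent P)
    (A : Ω → SymMat d → SymMat d) (ξ : SymMat d) : SymMat d :=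
  ∫ ω, flux τ p A ξ ω ∂P

/-- The minimal energy `f(ξ) = min_{v ∈ 𝒢} ∫ |ξ + v|^p / p dP`. -/
def minEnergy (τ : EuclideanSpace ℝ (Fin d) → Ω → Ω) (p : VariableExponent P)
    (ξ : SymMat d) : ℝ :=
  sInf ((fun v : VarLp (SymMat d) p => ∫ ω, ‖ξ + v ω‖ ^ p ω / p ω ∂P) '' strainSpace τ p)

/-- The conjugate functional
`f^*(η) = min {∫ |w|^{p'} / p' dP : w ∈ 𝒢^⊥, ∫ w dP = η}`. -/
def conjEnergy (τ : EuclideanSpace ℝ (Fin d) → Ω → Ω) (p : VariableExponent P)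
    (η : SymMat d) : ℝ :=
  sInf ((fun w : VarLp (SymMat d) p.conj => ∫ ω, ‖w ω‖ ^ p.conj ω / p.conj ω ∂P) ''
    {w | w ∈ strainSpacePerp τ p ∧ ∫ ω, w ω ∂P = η})

end Homogenization

end

/-!
The proof is the theory of monotone operators on the closed subspace `𝒢(Ω)` of `L^{p(·)}(Ω)`,
arranged so that neither reflexivity nor a description of the dual of `L^{p(·)}` is used.

*The cell problem.* The Nemytskii operator `u ↦ A(·, u(·))` maps `L^{p(·)}` monotonically and
continuously into `L^{p'(·)}` (`IsAdmissible.continuous_nemytskii`). On a ball of `𝒢(Ω)` the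
variational inequality is the assertion that the closed convex sets `{x | 0 ≤ T y (y - x)}` have a
common point. Finitely many of them do, by the minimax theorem and monotonicity. To pass to the whole
family, weak compactness is replaced by uniform convexity of the modular `∫ |φ|^p dP`: almost minimal
points of finite intersections are close to each other, and `L^{p(·)}` is complete
(`exists_variationalInequality`). Minty's argument and coercivity then give the equation
(`IsAdmissible.exists_pairing_nemytskii_eq_zero`), and strict monotonicity gives uniqueness.

*Strict monotonicity.* Since the fluxes annihilate `𝒢(Ω)`, microscopic and macroscopic work coincide
(`pairing_sub_totalStrain`). So `(A^eff(ξ) - A^eff(η)) · (ξ - η)` is the integral of the pointwise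
monotonicity term of the total strains; if it vanishes, then the total strains agree, and so do their
means `ξ` and `η`, because stationarity gives the elements of `𝒢(Ω)` mean zero.

*Continuity.* By the same identity the monotonicity term tends to zero in `L¹` when `ξ` converges. The
Leray–Lions argument `IsAdmissible.tendsto_nemytskii_of_tendsto_pairing` turns this into convergence
of the fluxes in the norm of `L^{p'(·)}`, which is more than weak convergence and implies continuity
of `A^eff`.

*Growth.* Testing the cell problem with `v_ξ - v` shows that the total strain is a quasi-minimizer
of the modular over `ξ + 𝒢(Ω)` (`exists_modular_totalStrain_le`). The flux is a competitor in the
definition of `f^*(A^eff(ξ))`.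
-/

/-! ### A monotone finite game -/

/-- A minimax argument: in the zero-sum game with payoff `y ↦ -∑ y i * B i j * x j` a saddle
point has value at most zero, because the quadratic form of `B` is nonnegative on the simplex. -/
theorem exists_mem_stdSimplex_forall_nonneg {ι : Type*} [Fintype ι] [Nonempty ι]
    (B : ι → ι → ℝ) (hB : ∀ i j, 0 ≤ B i j + B j i) :
    ∃ w ∈ stdSimplex ℝ ι, ∀ i, 0 ≤ ∑ j, B i j * w j := by
  classical
  have hne : (stdSimplex ℝ ι).Nonempty :=
    ⟨_, single_mem_stdSimplex ℝ (Classical.arbitrary ι)⟩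
  have hconv := convex_stdSimplex ℝ ι
  have hcomp := isCompact_stdSimplex ℝ ι
  let f : (ι → ℝ) → (ι → ℝ) → ℝ := fun x y => -∑ i, ∑ j, y i * B i j * x j
  have hlx : ∀ y, ∃ l : (ι → ℝ) →ₗ[ℝ] ℝ, ∀ x, f x y = l x := fun y =>
    ⟨-∑ i, ∑ j, (y i * B i j) • LinearMap.proj j, fun x => by simp [f]⟩
  have hly : ∀ x, ∃ l : (ι → ℝ) →ₗ[ℝ] ℝ, ∀ y, f x y = l y := fun x =>
    ⟨-∑ i, ∑ j, (B i j * x j) • LinearMap.proj i, fun y => by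
      simp only [f, LinearMap.neg_apply, LinearMap.sum_apply, LinearMap.smul_apply,
        LinearMap.proj_apply, smul_eq_mul]
      congr 1
      exact Finset.sum_congr rfl fun i _ => Finset.sum_congr rfl fun j _ => by ring⟩
  obtain ⟨a, ha, b, hb, hab⟩ := Sion.exists_isSaddlePointOn (f := f) hne hconv hcomp
    (fun y _ => by
      have : Continuous fun x => f x y := by fun_prop
      exact this.lowerSemicontinuous.lowerSemicontinuousOn _)
    (fun y _ => by
      obtain ⟨l, hl⟩ := hlx y
      simp only [hl]
      exact (l.convexOn hconv).quasiconvexOn) hconv hne hcomp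
    (fun x _ => by
      have : Continuous fun y => f x y := by fun_prop
      exact this.upperSemicontinuous.upperSemicontinuousOn _)
    (fun x _ => by
      obtain ⟨l, hl⟩ := hly x
      have : (fun y => f x y) = l := funext hl
      rw [show f x = l from this]
      exact (l.concaveOn hconv).quasiconcaveOn)
  refine ⟨a, ha, fun i => ?_⟩
  have h := hab b hb (Pi.single i 1) (single_mem_stdSimplex ℝ i)
  have h1 : f a (Pi.single i 1) = -∑ j, B i j * a j := by
    simp [f, Pi.single_apply, ite_mul]
  have h2 : 0 ≤ ∑ i, ∑ j, b i * B i j * b j := by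
    have h3 : ∑ i, ∑ j, b i * B i j * b j = ∑ i, ∑ j, b i * B j i * b j := by
      rw [Finset.sum_comm]
      exact Finset.sum_congr rfl fun i _ => Finset.sum_congr rfl fun j _ => by ring
    have h4 : 0 ≤ ∑ i, ∑ j, b i * (B i j + B j i) * b j :=
      Finset.sum_nonneg fun i _ => Finset.sum_nonneg fun j _ =>
        mul_nonneg (mul_nonneg (hb.1 i) (hB i j)) (hb.1 j)
    simp only [mul_add, add_mul, Finset.sum_add_distrib] at h4
    linarith
  have h5 : f b b = -∑ i, ∑ j, b i * B i j * b j := rfl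
  linarith

/-! ### Families of closed convex sets and uniformly convex functionals -/

/-- A substitute for weak compactness. A family of closed convex sets with the finite intersection
property inside `K` has a common point as soon as `K` carries a bounded uniformly convex functional:
the almost minimizers of `Φ` over finite intersections form a Cauchy filter. -/
theorem exists_forall_mem_of_uniformlyConvex {X ι : Type*} [NormedAddCommGroup X]
    [NormedSpace ℝ X] [CompleteSpace X] {Φ : X → ℝ} (hΦ : ∀ x, 0 ≤ Φ x) {K : Set X}
    {M : ℝ} (hM : ∀ x ∈ K, Φ x ≤ M)
    (hUC : ∀ ε > 0, ∃ δ > 0, ∀ x ∈ K, ∀ y ∈ K,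
      (Φ x + Φ y) / 2 - Φ ((2 : ℝ)⁻¹ • (x + y)) < δ → dist x y ≤ ε)
    (hK : IsClosed K) (hKc : Convex ℝ K) {C : ι → Set X} (hC : ∀ i, IsClosed (C i))
    (hCc : ∀ i, Convex ℝ (C i))
    (hfin : ∀ s : Finset ι, (K ∩ ⋂ i ∈ s, C i).Nonempty) :
    ∃ x ∈ K, ∀ i, x ∈ C i := by
  classical
  set D : Finset ι → Set X := fun s => K ∩ ⋂ i ∈ s, C i with hD
  have hDanti : ∀ s t, s ⊆ t → D t ⊆ D s := fun s t hst x hx =>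
    ⟨hx.1, Set.biInter_subset_biInter_left hst hx.2⟩
  have hDconv : ∀ s, Convex ℝ (D s) := fun s =>
    hKc.inter (convex_iInter₂ fun i _ => hCc i)
  set m : Finset ι → ℝ := fun s => sInf (Φ '' D s) with hm
  have hbdd : ∀ s, BddBelow (Φ '' D s) := fun s => ⟨0, by rintro _ ⟨x, _, rfl⟩; exact hΦ x⟩
  have hmle : ∀ s, m s ≤ M := fun s => by
    obtain ⟨x, hx⟩ := hfin s
    exact (csInf_le (hbdd s) ⟨x, hx, rfl⟩).trans (hM x hx.1)
  have hmb : BddAbove (Set.range m) := ⟨M, by rintro _ ⟨s, rfl⟩; exact hmle s⟩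
  set N := ⨆ s, m s with hN
  -- almost minimizers over a small enough intersection are close to each other
  have key : ∀ ε > 0, ∃ δ > 0, ∃ s, ∀ x ∈ D s, ∀ y ∈ D s, Φ x < N + δ → Φ y < N + δ →
      dist x y ≤ ε := by
    intro ε hε
    obtain ⟨δ, hδ, h⟩ := hUC ε hε
    obtain ⟨s, hs⟩ := exists_lt_of_lt_ciSup (show N - δ / 2 < ⨆ s, m s by rw [← hN]; linarith)
    refine ⟨δ / 2, by linarith, s, fun x hx y hy hxN hyN => h x hx.1 y hy.1 ?_⟩
    have hmid : (2 : ℝ)⁻¹ • (x + y) ∈ D s := by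
      rw [smul_add]
      exact hDconv s hx hy (by norm_num) (by norm_num) (by norm_num)
    have := csInf_le (hbdd s) ⟨_, hmid, rfl⟩
    have h1 : m s = sInf (Φ '' D s) := rfl
    linarith
  have hex : ∀ s, ∀ δ > 0, ∃ x ∈ D s, Φ x < N + δ := by
    intro s δ hδ
    have h1 : m s < N + δ := by linarith [le_ciSup hmb s]
    obtain ⟨_, ⟨x, hx, rfl⟩, hlt⟩ := exists_lt_of_csInf_lt ((hfin s).image Φ) h1
    exact ⟨x, hx, hlt⟩
  let F : Filter X := ⨅ q : Finset ι × Set.Ioi (0 : ℝ), 𝓟 {x | x ∈ D q.1 ∧ Φ x < N + q.2}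
  have hdir : Directed (· ≥ ·) fun q : Finset ι × Set.Ioi (0 : ℝ) =>
      𝓟 {x | x ∈ D q.1 ∧ Φ x < N + q.2} := by
    rintro ⟨s, δ, hδ⟩ ⟨t, η, hη⟩
    refine ⟨⟨s ∪ t, min δ η, Set.mem_Ioi.2 (lt_min hδ hη)⟩, ?_, ?_⟩
    · refine principal_mono.2 fun x hx => ⟨hDanti _ _ Finset.subset_union_left hx.1, ?_⟩
      exact hx.2.trans_le (by simp)
    · refine principal_mono.2 fun x hx => ⟨hDanti _ _ Finset.subset_union_right hx.1, ?_⟩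
      exact hx.2.trans_le (by simp)
  have : Nonempty (Finset ι × Set.Ioi (0 : ℝ)) := ⟨⟨∅, 1, Set.mem_Ioi.2 one_pos⟩⟩
  have hFne : F.NeBot := by
    refine iInf_neBot_of_directed' hdir fun q => ?_
    obtain ⟨x, hx⟩ := hex q.1 q.2 q.2.2
    exact principal_neBot_iff.2 ⟨x, hx⟩
  have hFmem : ∀ s, D s ∈ F := fun s =>
    mem_of_superset (mem_iInf_of_mem (⟨s, 1, Set.mem_Ioi.2 one_pos⟩ : Finset ι × Set.Ioi (0 : ℝ))
      (mem_principal_self _)) fun x hx => hx.1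
  have hFc : Cauchy F := by
    refine Metric.cauchy_iff.2 ⟨hFne, fun ε hε => ?_⟩
    obtain ⟨δ, hδ, s, h⟩ := key (ε / 2) (by linarith)
    refine ⟨_, mem_iInf_of_mem (⟨s, δ, hδ⟩ : Finset ι × Set.Ioi (0 : ℝ))
      (mem_principal_self _), fun x hx y hy => ?_⟩
    linarith [h x hx.1 y hy.1 hx.2 hy.2]
  obtain ⟨x, hx⟩ := CompleteSpace.complete hFc
  refine ⟨x, ?_, fun i => ?_⟩
  · exact hK.mem_of_tendsto (f := id) (b := F) hx (mem_of_superset (hFmem ∅) fun y hy => hy.1)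
  · refine (hC i).mem_of_tendsto (f := id) (b := F) hx
      (mem_of_superset (hFmem {i}) fun y hy => ?_)
    simpa using hy.2

/-! ### Variational inequalities for monotone operators -/

/-- Minty's form of the variational inequality for a monotone operator. No continuity of `T` is
needed: each set `{x | 0 ≤ T y (y - x)}` is closed and convex, and finitely many of them meet in the
convex hull of the corresponding points `y`. -/
theorem exists_variationalInequality {X : Type*} [NormedAddCommGroup X]
    [NormedSpace ℝ X] [CompleteSpace X] {Φ : X → ℝ} (hΦ : ∀ x, 0 ≤ Φ x) {K : Set X}
    {M : ℝ} (hM : ∀ x ∈ K, Φ x ≤ M)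
    (hUC : ∀ ε > 0, ∃ δ > 0, ∀ x ∈ K, ∀ y ∈ K,
      (Φ x + Φ y) / 2 - Φ ((2 : ℝ)⁻¹ • (x + y)) < δ → dist x y ≤ ε)
    (hK : IsClosed K) (hKc : Convex ℝ K) (hne : K.Nonempty) (T : X → X →L[ℝ] ℝ)
    (hT : ∀ x ∈ K, ∀ y ∈ K, 0 ≤ (T x - T y) (x - y)) :
    ∃ x ∈ K, ∀ y ∈ K, 0 ≤ T y (y - x) := by
  have hfin : ∀ s : Finset K, (K ∩ ⋂ y ∈ s, {x | T y x ≤ T y y}).Nonempty := by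
    intro s
    rcases s.eq_empty_or_nonempty with rfl | hs
    · simpa using hne
    have : Nonempty s := hs.to_subtype
    obtain ⟨w, hw, hw'⟩ := exists_mem_stdSimplex_forall_nonneg
      (fun i j : s => T (i : K) ((i : K) - (j : K) : X)) (fun i j => by
        have := hT _ (i : K).2 _ (j : K).2
        simp only [sub_apply, map_sub] at this ⊢
        linarith)
    refine ⟨∑ j : s, w j • ((j : K) : X), ?_, ?_⟩
    · exact hKc.sum_mem (fun j _ => hw.1 j) hw.2 fun j _ => (j : K).2
    · simp only [Set.mem_iInter]
      intro i hi
      have := hw' ⟨i, hi⟩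
      simp only [map_sub, sub_mul, Finset.sum_sub_distrib, ← Finset.mul_sum, hw.2] at this
      simp only [Set.mem_ofPred_eq, map_sum, map_smul, smul_eq_mul]
      calc _ = ∑ j : s, T i ((j : K) : X) * w j := Finset.sum_congr rfl fun j _ => mul_comm _ _
        _ ≤ _ := by linarith
  obtain ⟨x, hx, h⟩ := exists_forall_mem_of_uniformlyConvex (ι := K) hΦ hM hUC hK hKc
    (fun y => isClosed_le (T y).continuous continuous_const)
    (fun y => (convex_Iic (T y y)).is_linear_preimage (T y).isLinear) hfin
  exact ⟨x, hx, fun y hy => by rw [map_sub]; linarith [show T y x ≤ T y y from h ⟨y, hy⟩]⟩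

/-! ### Pointwise inequalities -/

/-- Young's inequality with `ε`, with a constant that is uniform for exponents `q ≤ B`. -/
theorem mul_le_eps_rpow_add_rpow {a b q q' B ε : ℝ} (ha : 0 ≤ a) (hb : 0 ≤ b)
    (hq : q'.HolderConjugate q) (hB : q ≤ B) (hε : 0 < ε) (hε1 : ε ≤ 1) :
    a * b ≤ ε * a ^ q' + ε ^ (-B) * b ^ q := by
  have hq1 := hq.lt
  have hq2 := hq.symm.lt
  have h1 := Real.young_inequality_of_nonneg (mul_nonneg hε.le ha)
    (mul_nonneg (inv_nonneg.2 hε.le) hb) hq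
  have h2 : ε * a * (ε⁻¹ * b) = a * b := by field_simp
  rw [h2, Real.mul_rpow hε.le ha, Real.mul_rpow (inv_nonneg.2 hε.le) hb] at h1
  have ha' := Real.rpow_nonneg ha q'
  have hb' := Real.rpow_nonneg hb q
  have h3 : ε ^ q' ≤ ε := by
    simpa using Real.rpow_le_rpow_of_exponent_ge hε hε1 hq1.le
  have h4 : ε⁻¹ ^ q ≤ ε ^ (-B) := by
    rw [Real.inv_rpow hε.le, ← Real.rpow_neg hε.le]
    exact Real.rpow_le_rpow_of_exponent_ge hε hε1 (by linarith)
  calc a * b ≤ ε ^ q' * a ^ q' / q' + ε⁻¹ ^ q * b ^ q / q := h1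
    _ ≤ ε ^ q' * a ^ q' + ε⁻¹ ^ q * b ^ q := by
        gcongr
        · exact div_le_self (by positivity) hq1.le
        · exact div_le_self (by positivity) hq2.le
    _ ≤ _ := by gcongr

theorem norm_add_rpow_le {E : Type*} [SeminormedAddCommGroup E] {q B : ℝ} (hq : 1 ≤ q)
    (hB : q ≤ B) (a b : E) : ‖a + b‖ ^ q ≤ 2 ^ B * (‖a‖ ^ q + ‖b‖ ^ q) := by
  have h1 : ‖a + b‖ ^ q ≤ (2 * max ‖a‖ ‖b‖) ^ q := by
    refine Real.rpow_le_rpow (norm_nonneg _) ((norm_add_le a b).trans ?_) (by linarith)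
    linarith [le_max_left ‖a‖ ‖b‖, le_max_right ‖a‖ ‖b‖]
  rw [Real.mul_rpow (by norm_num) (by positivity)] at h1
  have ha := Real.rpow_nonneg (norm_nonneg a) q
  have hb := Real.rpow_nonneg (norm_nonneg b) q
  have h2 : max ‖a‖ ‖b‖ ^ q ≤ ‖a‖ ^ q + ‖b‖ ^ q := by
    rcases max_choice ‖a‖ ‖b‖ with h | h <;> rw [h] <;> linarith
  refine h1.trans ?_
  gcongr
  norm_num

theorem norm_sub_rpow_le {E : Type*} [SeminormedAddCommGroup E] {q B : ℝ} (hq : 1 ≤ q)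
    (hB : q ≤ B) (a b : E) : ‖a - b‖ ^ q ≤ 2 ^ B * (‖a‖ ^ q + ‖b‖ ^ q) := by
  simpa [sub_eq_add_neg] using norm_add_rpow_le hq hB a (-b)

theorem norm_midpoint_rpow_lt {E : Type*} [NormedAddCommGroup E] [NormedSpace ℝ E]
    [StrictConvexSpace ℝ E] {q : ℝ} (hq : 1 < q) {a b : E} (hab : a ≠ b) :
    ‖(2 : ℝ)⁻¹ • (a + b)‖ ^ q < (‖a‖ ^ q + ‖b‖ ^ q) / 2 := by
  by_cases h : ‖a‖ = ‖b‖
  · have h1 : ‖(2 : ℝ)⁻¹ • (a + b)‖ < ‖a‖ := by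
      simpa using (norm_midpoint_lt_iff h).2 hab
    have h2 := Real.rpow_lt_rpow (norm_nonneg _) h1 (by linarith : 0 < q)
    rw [← h]
    linarith
  · have h1 := (strictConvexOn_rpow hq).2 (norm_nonneg a) (norm_nonneg b) h
      (by norm_num : (0 : ℝ) < 2⁻¹) (by norm_num : (0 : ℝ) < 2⁻¹) (by norm_num)
    simp only [smul_eq_mul] at h1
    have h2 : ‖(2 : ℝ)⁻¹ • (a + b)‖ ≤ 2⁻¹ * ‖a‖ + 2⁻¹ * ‖b‖ := by
      rw [norm_smul, Real.norm_of_nonneg (by norm_num)]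
      linarith [norm_add_le a b]
    have h3 := Real.rpow_le_rpow (norm_nonneg _) h2 (by linarith : 0 ≤ q)
    linarith

theorem norm_midpoint_rpow_le {E : Type*} [NormedAddCommGroup E] [NormedSpace ℝ E]
    [StrictConvexSpace ℝ E] {q : ℝ} (hq : 1 < q) (a b : E) :
    ‖(2 : ℝ)⁻¹ • (a + b)‖ ^ q ≤ (‖a‖ ^ q + ‖b‖ ^ q) / 2 := by
  rcases eq_or_ne a b with rfl | h
  · rw [← two_smul ℝ a, smul_smul]
    simp
  · exact (norm_midpoint_rpow_lt hq h).le

/-- The convexity gap of `‖·‖ ^ q` is bounded below uniformly in `q ∈ [α, β]`, by compactness. -/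
theorem exists_pos_le_convexityGap {E : Type*} [NormedAddCommGroup E] [NormedSpace ℝ E]
    [StrictConvexSpace ℝ E] [FiniteDimensional ℝ E] {α β ε : ℝ} (hα : 1 < α) (hε : 0 < ε) :
    ∃ δ > 0, ∀ q, α ≤ q → q ≤ β → ∀ a b : E, ‖a‖ ≤ 1 → ‖b‖ ≤ 1 → ε ≤ ‖a - b‖ →
      δ ≤ (‖a‖ ^ q + ‖b‖ ^ q) / 2 - ‖(2 : ℝ)⁻¹ • (a + b)‖ ^ q := by
  set S : Set (ℝ × E × E) := (Set.Icc α β ×ˢ Metric.closedBall 0 1 ×ˢ Metric.closedBall 0 1) ∩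
    {x | ε ≤ ‖x.2.1 - x.2.2‖} with hS
  have hSc : IsCompact S := by
    refine (isCompact_Icc.prod ((isCompact_closedBall _ _).prod
      (isCompact_closedBall _ _))).inter_right ?_
    exact isClosed_le continuous_const (by fun_prop)
  have hcont : ContinuousOn (fun x : ℝ × E × E =>
      (‖x.2.1‖ ^ x.1 + ‖x.2.2‖ ^ x.1) / 2 - ‖(2 : ℝ)⁻¹ • (x.2.1 + x.2.2)‖ ^ x.1) S := by
    have hpos : ∀ x ∈ S, 0 < x.1 := fun x hx => by linarith [hx.1.1.1]
    refine ContinuousOn.sub (ContinuousOn.div_const (ContinuousOn.add ?_ ?_) _) ?_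
    all_goals
      refine ContinuousOn.rpow (by fun_prop) (by fun_prop) fun x hx => Or.inr (hpos x hx)
  rcases S.eq_empty_or_nonempty with hem | hne
  · refine ⟨1, one_pos, fun q h1 h2 a b ha hb hab => absurd (?_ : (q, a, b) ∈ S) (by simp [hem])⟩
    exact ⟨⟨⟨h1, h2⟩, by simpa using ha, by simpa using hb⟩, hab⟩
  · obtain ⟨x, hx, hmin⟩ := hSc.exists_isMinOn hne hcont
    refine ⟨_, sub_pos.2 (norm_midpoint_rpow_lt (by linarith [hx.1.1.1]) ?_),
      fun q h1 h2 a b ha hb hab => hmin (a := (q, a, b))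
        ⟨⟨⟨h1, h2⟩, by simpa using ha, by simpa using hb⟩, hab⟩⟩
    intro h
    have : ε ≤ ‖x.2.1 - x.2.2‖ := hx.2
    rw [h, sub_self, norm_zero] at this
    linarith

/-- A homogeneous form of uniform convexity which can be integrated even when the exponent `q` varies
in `[α, β]` from point to point. -/
theorem exists_norm_sub_rpow_le_convexityGap {E : Type*} [NormedAddCommGroup E]
    [NormedSpace ℝ E] [StrictConvexSpace ℝ E] [FiniteDimensional ℝ E] {α β ε : ℝ}
    (hα : 1 < α) (hε : 0 < ε) (hε1 : ε ≤ 1) :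
    ∃ C > 0, ∀ q, α ≤ q → q ≤ β → ∀ a b : E, ‖a - b‖ ^ q ≤ ε * (‖a‖ ^ q + ‖b‖ ^ q) +
      C * ((‖a‖ ^ q + ‖b‖ ^ q) / 2 - ‖(2 : ℝ)⁻¹ • (a + b)‖ ^ q) := by
  obtain ⟨δ, hδ, h⟩ := exists_pos_le_convexityGap (E := E) (β := β) hα hε
  refine ⟨2 ^ β / δ, by positivity, fun q h1 h2 a b => ?_⟩
  have hq : 1 < q := by linarith
  have ha := Real.rpow_nonneg (norm_nonneg a) q
  have hb := Real.rpow_nonneg (norm_nonneg b) q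
  have hgap := sub_nonneg.2 (norm_midpoint_rpow_le hq a b)
  set m := max ‖a‖ ‖b‖ with hm
  have hm0 : 0 ≤ m := by positivity
  have hmq : m ^ q ≤ ‖a‖ ^ q + ‖b‖ ^ q := by
    rcases max_choice ‖a‖ ‖b‖ with h | h <;> rw [hm, h] <;> linarith
  by_cases hab : ‖a - b‖ ≤ ε * m
  · have h3 : ‖a - b‖ ^ q ≤ ε * m ^ q := by
      refine (Real.rpow_le_rpow (norm_nonneg _) hab (by linarith)).trans ?_
      rw [Real.mul_rpow hε.le hm0]
      gcongr
      simpa using Real.rpow_le_rpow_of_exponent_ge hε hε1 hq.le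
    have h4 : ε * m ^ q ≤ ε * (‖a‖ ^ q + ‖b‖ ^ q) := by gcongr
    have h5 : 0 ≤ 2 ^ β / δ * ((‖a‖ ^ q + ‖b‖ ^ q) / 2 - ‖(2 : ℝ)⁻¹ • (a + b)‖ ^ q) := by
      positivity
    linarith
  · push Not at hab
    have hmpos : 0 < m := by
      rcases hm0.eq_or_lt with h0 | h0
      · have h3 : ‖a‖ ≤ 0 := (le_max_left _ _).trans h0.ge
        have h4 : ‖b‖ ≤ 0 := (le_max_right _ _).trans h0.ge
        have h5 := norm_sub_le a b
        rw [← h0, mul_zero] at hab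
        linarith
      · exact h0
    -- both sides are homogeneous of degree `q`, so `a` and `b` may be scaled into the unit ball
    have hs : ∀ x : E, ‖m⁻¹ • x‖ ^ q = (m ^ q)⁻¹ * ‖x‖ ^ q := fun x => by
      rw [norm_smul, Real.norm_of_nonneg (by positivity),
        Real.mul_rpow (by positivity) (norm_nonneg _), Real.inv_rpow hm0]
    have h3 := h q h1 h2 (m⁻¹ • a) (m⁻¹ • b)
      (by rw [norm_smul, Real.norm_of_nonneg (by positivity), inv_mul_le_one₀ hmpos]
          exact le_max_left _ _)
      (by rw [norm_smul, Real.norm_of_nonneg (by positivity), inv_mul_le_one₀ hmpos]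
          exact le_max_right _ _)
      (by rw [← smul_sub, norm_smul, Real.norm_of_nonneg (by positivity), inv_mul_eq_div,
            le_div_iff₀ hmpos]
          exact hab.le)
    rw [← smul_add, smul_comm, hs, hs, hs] at h3
    have hmqpos : 0 < m ^ q := by positivity
    have h4 : δ * m ^ q ≤ (‖a‖ ^ q + ‖b‖ ^ q) / 2 - ‖(2 : ℝ)⁻¹ • (a + b)‖ ^ q := by
      have := mul_le_mul_of_nonneg_right h3 hmqpos.le
      refine this.trans (le_of_eq ?_)
      field_simp
    have h5 : ‖a - b‖ ^ q ≤ 2 ^ β * m ^ q := by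
      have h6 : ‖a - b‖ ≤ 2 * m := by
        linarith [norm_sub_le a b, le_max_left ‖a‖ ‖b‖, le_max_right ‖a‖ ‖b‖]
      refine (Real.rpow_le_rpow (norm_nonneg _) h6 (by linarith)).trans ?_
      rw [Real.mul_rpow (by norm_num) hm0]
      gcongr
      norm_num
    have h6 : 2 ^ β * m ^ q ≤
        2 ^ β / δ * ((‖a‖ ^ q + ‖b‖ ^ q) / 2 - ‖(2 : ℝ)⁻¹ • (a + b)‖ ^ q) := by
      calc 2 ^ β * m ^ q = 2 ^ β / δ * (δ * m ^ q) := by field_simp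
        _ ≤ _ := by gcongr
    have h7 : 0 ≤ ε * (‖a‖ ^ q + ‖b‖ ^ q) := by positivity
    linarith

/-! ### Strictly monotone maps in finite dimension -/

theorem exists_pos_le_inner_of_strictMono {E : Type*} [NormedAddCommGroup E]
    [InnerProductSpace ℝ E] [FiniteDimensional ℝ E] {F : E → E} (hF : Continuous F)
    (hmono : ∀ a b, a ≠ b → 0 < inner ℝ (F a - F b) (a - b)) (a : E) {ε : ℝ} (hε : 0 < ε) :
    ∃ δ > 0, ∀ b, ε ≤ ‖b - a‖ → δ ≤ inner ℝ (F b - F a) (b - a) := by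
  have hmono' : ∀ a b, 0 ≤ inner ℝ (F a - F b) (a - b) := fun a b => by
    rcases eq_or_ne a b with rfl | h
    · simp
    · exact (hmono a b h).le
  -- along a ray from `a` the inner product increases, so it suffices to bound it on a sphere
  have hray : ∀ b, ε ≤ ‖b - a‖ → ∃ c ∈ Metric.sphere a ε,
      inner ℝ (F c - F a) (c - a) ≤ inner ℝ (F b - F a) (b - a) := by
    intro b hb
    have hba : 0 < ‖b - a‖ := by linarith
    set t := ε / ‖b - a‖ with ht
    have ht0 : 0 < t := by positivity
    have ht1 : t ≤ 1 := (div_le_one hba).2 hb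
    refine ⟨a + t • (b - a), ?_, ?_⟩
    · simp [norm_smul, ht, abs_of_pos hε, div_mul_cancel₀ _ hba.ne']
    · rcases ht1.eq_or_lt with h1 | h1
      · simp [h1]
      · have h2 := hmono' b (a + t • (b - a))
        have h3 : b - (a + t • (b - a)) = (1 - t) • (b - a) := by module
        rw [h3, inner_smul_right] at h2
        have h4 := nonneg_of_mul_nonneg_right h2 (by linarith)
        have h5 : inner ℝ (F (a + t • (b - a)) - F a) (b - a) ≤
            inner ℝ (F b - F a) (b - a) := by
          simp only [inner_sub_left] at h4 ⊢
          linarith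
        have h6 := hmono' b a
        rw [add_sub_cancel_left, inner_smul_right]
        calc _ ≤ t * inner ℝ (F b - F a) (b - a) := by gcongr
          _ ≤ 1 * inner ℝ (F b - F a) (b - a) := by gcongr
          _ = _ := one_mul _
  rcases (Metric.sphere a ε).eq_empty_or_nonempty with hem | hne
  · refine ⟨1, one_pos, fun b hb => ?_⟩
    obtain ⟨c, hc, -⟩ := hray b hb
    simp [hem] at hc
  · obtain ⟨c, hc, hmin⟩ := (isCompact_sphere a ε).exists_isMinOn hne
      (f := fun c => inner ℝ (F c - F a) (c - a)) (by fun_prop)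
    refine ⟨_, hmono c a ?_, fun b hb => ?_⟩
    · rintro rfl
      simp at hc
      linarith
    · obtain ⟨e, he, hle⟩ := hray b hb
      exact (hmin he).trans hle

theorem tendsto_of_tendsto_inner_of_strictMono {E ι : Type*} [NormedAddCommGroup E]
    [InnerProductSpace ℝ E] [FiniteDimensional ℝ E] {F : E → E} (hF : Continuous F)
    (hmono : ∀ a b, a ≠ b → 0 < inner ℝ (F a - F b) (a - b)) {l : Filter ι} {u : ι → E} {a : E}
    (h : Tendsto (fun i => inner ℝ (F (u i) - F a) (u i - a)) l (𝓝 0)) :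
    Tendsto u l (𝓝 a) := by
  refine Metric.tendsto_nhds.2 fun ε hε => ?_
  obtain ⟨δ, hδ, hle⟩ := exists_pos_le_inner_of_strictMono hF hmono a hε
  filter_upwards [h.eventually_lt_const hδ] with i hi
  by_contra hcon
  rw [not_lt, dist_eq_norm] at hcon
  linarith [hle _ hcon]

/-! ### Modulars and norms in Lebesgue spaces with variable exponent -/

namespace VariableExponent

variable {Ω : Type*} [MeasurableSpace Ω] {P : Measure Ω}

theorem pos (p : VariableExponent P) (ω : Ω) : 0 < p ω := one_pos.trans (p.one_lt ω)

theorem one_lt_β (p : VariableExponent P) : 1 < p.β := p.one_lt_α.trans_le p.α_le_β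

theorem holderConjugate (p : VariableExponent P) (ω : Ω) :
    (p ω).HolderConjugate (p.conj ω) :=
  Real.HolderConjugate.conjExponent (p.one_lt ω)

end VariableExponent

namespace VarLp

variable {Ω : Type*} [MeasurableSpace Ω] {P : Measure Ω} {p : VariableExponent P}
variable {E : Type*} [NormedAddCommGroup E]

theorem lintegral_enorm_rpow_eq {f : Ω → E} {l : ℝ} (hl : 0 < l)
    (hf : Integrable (fun ω => (‖f ω‖ / l) ^ p ω) P) :
    ∫⁻ ω, (‖f ω‖ₑ / ENNReal.ofReal l) ^ p ω ∂P =
      ENNReal.ofReal (∫ ω, (‖f ω‖ / l) ^ p ω ∂P) := by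
  rw [ofReal_integral_eq_lintegral_ofReal hf (Eventually.of_forall fun ω => by positivity)]
  refine lintegral_congr fun ω => ?_
  rw [← ofReal_norm, ← ENNReal.ofReal_div_of_pos hl,
    ENNReal.ofReal_rpow_of_nonneg (by positivity) (p.pos ω).le]

theorem aestronglyMeasurable_norm_rpow {f : Ω → E} (hf : AEStronglyMeasurable f P) :
    AEStronglyMeasurable (fun ω => ‖f ω‖ ^ p ω) P :=
  (hf.norm.aemeasurable.pow p.aemeasurable).aestronglyMeasurable

theorem enorm_norm_rpow (f : Ω → E) (ω : Ω) : ‖‖f ω‖ ^ p ω‖ₑ = ‖f ω‖ₑ ^ p ω := by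
  rw [Real.enorm_rpow_of_nonneg (norm_nonneg _) (p.pos ω).le, enorm_norm]

variable [NormedSpace ℝ E]

theorem aestronglyMeasurable (φ : VarLp E p) : AEStronglyMeasurable (fun ω => φ ω) P :=
  φ.1.aestronglyMeasurable

theorem coeFn_sub (φ ψ : VarLp E p) : ∀ᵐ ω ∂P, (φ - ψ) ω = φ ω - ψ ω :=
  AEEqFun.coeFn_sub φ.1 ψ.1

theorem coeFn_zero : ∀ᵐ ω ∂P, (0 : VarLp E p) ω = 0 :=
  AEEqFun.coeFn_zero (α := Ω) (μ := P) (β := E)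

theorem ext_ae {φ ψ : VarLp E p} (h : ∀ᵐ ω ∂P, φ ω = ψ ω) : φ = ψ :=
  Subtype.ext (AEEqFun.ext h)

theorem integrable_rpow (φ : VarLp E p) : Integrable (fun ω => ‖φ ω‖ ^ p ω) P := by
  refine ⟨aestronglyMeasurable_norm_rpow φ.aestronglyMeasurable, ?_⟩
  rw [hasFiniteIntegral_iff_enorm]
  simp only [enorm_norm_rpow]
  exact φ.2

/-- The class of a function with finite modular. -/
noncomputable def ofFun (f : Ω → E) (hf : AEStronglyMeasurable f P)
    (hi : Integrable (fun ω => ‖f ω‖ ^ p ω) P) : VarLp E p :=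
  ⟨AEEqFun.mk f hf, by
    have h := hi.2
    rw [hasFiniteIntegral_iff_enorm] at h
    simp only [enorm_norm_rpow] at h
    refine (lintegral_congr_ae ?_).trans_lt h
    filter_upwards [AEEqFun.coeFn_mk f hf] with ω hω
    rw [hω]⟩

theorem coeFn_ofFun (f : Ω → E) (hf : AEStronglyMeasurable f P)
    (hi : Integrable (fun ω => ‖f ω‖ ^ p ω) P) : ∀ᵐ ω ∂P, ofFun f hf hi ω = f ω :=
  AEEqFun.coeFn_mk f hf

theorem ae_norm_div_rpow (φ : VarLp E p) {l : ℝ} (hl : 0 < l) :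
    ∀ᵐ ω ∂P, ‖(l⁻¹ • φ) ω‖ ^ p ω = (‖φ ω‖ / l) ^ p ω := by
  filter_upwards [coeFn_smul l⁻¹ φ] with ω hω
  rw [hω, norm_smul, Real.norm_of_nonneg (by positivity), inv_mul_eq_div]

theorem integrable_div_rpow (φ : VarLp E p) {l : ℝ} (hl : 0 < l) :
    Integrable (fun ω => (‖φ ω‖ / l) ^ p ω) P :=
  (l⁻¹ • φ).integrable_rpow.congr (ae_norm_div_rpow φ hl)

/-- The modular `∫ |φ|^p dP`. -/
noncomputable def modular (φ : VarLp E p) : ℝ := ∫ ω, ‖φ ω‖ ^ p ω ∂P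

theorem modular_nonneg (φ : VarLp E p) : 0 ≤ φ.modular :=
  integral_nonneg fun ω => by positivity

theorem norm_le_of_lintegral_le_one {φ : VarLp E p} {l : ℝ} (hl : 0 < l)
    (h : ∫⁻ ω, (‖φ ω‖ₑ / ENNReal.ofReal l) ^ p ω ∂P ≤ 1) : ‖φ‖ ≤ l :=
  csInf_le (bddBelow_set φ) ⟨hl, h⟩

theorem lintegral_le_one_of_norm_lt {φ : VarLp E p} {l : ℝ} (h : ‖φ‖ < l) :
    ∫⁻ ω, (‖φ ω‖ₑ / ENNReal.ofReal l) ^ p ω ∂P ≤ 1 := by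
  obtain ⟨m, ⟨hm, hle⟩, hml⟩ := exists_lt_of_csInf_lt (nonempty_set φ) h
  refine (lintegral_mono fun ω => ?_).trans hle
  exact ENNReal.rpow_le_rpow (ENNReal.div_le_div_left (ENNReal.ofReal_le_ofReal hml.le) _)
    (p.pos ω).le

theorem norm_le_of_integral_le_one {φ : VarLp E p} {l : ℝ} (hl : 0 < l)
    (h : ∫ ω, (‖φ ω‖ / l) ^ p ω ∂P ≤ 1) : ‖φ‖ ≤ l := by
  refine norm_le_of_lintegral_le_one hl ?_
  rw [lintegral_enorm_rpow_eq hl (φ.integrable_div_rpow hl)]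
  simpa using h

theorem integral_le_one_of_norm_lt {φ : VarLp E p} {l : ℝ} (h : ‖φ‖ < l) :
    ∫ ω, (‖φ ω‖ / l) ^ p ω ∂P ≤ 1 := by
  have hl : 0 < l := (norm_nonneg φ).trans_lt h
  have := lintegral_le_one_of_norm_lt h
  rw [lintegral_enorm_rpow_eq hl (φ.integrable_div_rpow hl)] at this
  simpa using this

theorem norm_le_of_modular_le {φ : VarLp E p} {ε : ℝ} (hε : 0 < ε) (hε1 : ε ≤ 1)
    (h : φ.modular ≤ ε ^ p.β) : ‖φ‖ ≤ ε := by
  refine norm_le_of_integral_le_one hε ?_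
  have hpos : 0 < ε ^ p.β := by positivity
  have hle : ∀ ω, (‖φ ω‖ / ε) ^ p ω ≤ (ε ^ p.β)⁻¹ * ‖φ ω‖ ^ p ω := fun ω => by
    rw [Real.div_rpow (norm_nonneg _) hε.le, div_eq_inv_mul]
    exact mul_le_mul_of_nonneg_right
      (inv_anti₀ hpos (Real.rpow_le_rpow_of_exponent_ge hε hε1 (p.le_β ω))) (by positivity)
  calc ∫ ω, (‖φ ω‖ / ε) ^ p ω ∂P ≤ ∫ ω, (ε ^ p.β)⁻¹ * ‖φ ω‖ ^ p ω ∂P :=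
        integral_mono (φ.integrable_div_rpow hε) (φ.integrable_rpow.const_mul _) hle
    _ = (ε ^ p.β)⁻¹ * φ.modular := integral_const_mul _ _
    _ ≤ (ε ^ p.β)⁻¹ * ε ^ p.β := by gcongr
    _ = 1 := inv_mul_cancel₀ hpos.ne'

theorem norm_le_max_one_modular (φ : VarLp E p) : ‖φ‖ ≤ max 1 φ.modular := by
  set l := max 1 φ.modular with hl
  have hl1 : 1 ≤ l := le_max_left _ _
  have hl0 : 0 < l := by linarith
  refine norm_le_of_integral_le_one hl0 ?_
  have hle : ∀ ω, (‖φ ω‖ / l) ^ p ω ≤ l⁻¹ * ‖φ ω‖ ^ p ω := fun ω => by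
    rw [Real.div_rpow (norm_nonneg _) hl0.le, div_eq_inv_mul]
    gcongr
    simpa using Real.rpow_le_rpow_of_exponent_le hl1 (p.one_lt ω).le
  calc ∫ ω, (‖φ ω‖ / l) ^ p ω ∂P ≤ ∫ ω, l⁻¹ * ‖φ ω‖ ^ p ω ∂P :=
        integral_mono (φ.integrable_div_rpow hl0) (φ.integrable_rpow.const_mul _) hle
    _ = l⁻¹ * φ.modular := integral_const_mul _ _
    _ ≤ l⁻¹ * l := by gcongr; exact le_max_right _ _
    _ = 1 := inv_mul_cancel₀ hl0.ne'

theorem modular_le_of_norm_lt {φ : VarLp E p} {l : ℝ} (hl : 1 ≤ l) (h : ‖φ‖ < l) :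
    φ.modular ≤ l ^ p.β := by
  have hl0 : 0 < l := by linarith
  have hle : ∀ ω, ‖φ ω‖ ^ p ω ≤ l ^ p.β * (‖φ ω‖ / l) ^ p ω := fun ω => by
    have h1 : ‖φ ω‖ = l * (‖φ ω‖ / l) := by field_simp
    conv_lhs => rw [h1, Real.mul_rpow hl0.le (by positivity)]
    gcongr
    exact p.le_β ω
  calc φ.modular ≤ ∫ ω, l ^ p.β * (‖φ ω‖ / l) ^ p ω ∂P :=
        integral_mono φ.integrable_rpow ((φ.integrable_div_rpow hl0).const_mul _) hle
    _ = l ^ p.β * ∫ ω, (‖φ ω‖ / l) ^ p ω ∂P := integral_const_mul _ _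
    _ ≤ l ^ p.β * 1 := by gcongr; exact integral_le_one_of_norm_lt h
    _ = _ := mul_one _

theorem tendsto_of_tendsto_modular {ι : Type*} {l : Filter ι} {u : ι → VarLp E p}
    {φ : VarLp E p} (h : Tendsto (fun i => (u i - φ).modular) l (𝓝 0)) :
    Tendsto u l (𝓝 φ) := by
  refine Metric.tendsto_nhds.2 fun ε hε => ?_
  set δ := min (ε / 2) 1 with hδ
  have hδ0 : 0 < δ := lt_min (by linarith) one_pos
  filter_upwards [h.eventually_lt_const (show 0 < δ ^ p.β by positivity)] with i hi
  rw [dist_eq_norm]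
  have h1 := norm_le_of_modular_le hδ0 (min_le_right _ _) hi.le
  have h2 : δ ≤ ε / 2 := min_le_left _ _
  linarith

/-! ### Embedding into `L¹` and completeness -/

section Prob

variable [IsProbabilityMeasure P]

theorem le_one_add_rpow {a q : ℝ} (ha : 0 ≤ a) (hq : 1 ≤ q) : a ≤ 1 + a ^ q := by
  rcases le_total a 1 with h | h
  · linarith [Real.rpow_nonneg ha q]
  · have := Real.rpow_le_rpow_of_exponent_le h hq
    rw [Real.rpow_one] at this
    linarith

theorem integrable (φ : VarLp E p) : Integrable (fun ω => φ ω) P := by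
  refine ((integrable_const (1 : ℝ)).add φ.integrable_rpow).mono' φ.aestronglyMeasurable
    (Eventually.of_forall fun ω => ?_)
  exact le_one_add_rpow (norm_nonneg _) (p.one_lt ω).le

/-- The constant comes from `a ≤ 1 + a ^ q`, applied to `‖φ‖ / l`. -/
theorem integral_norm_le (φ : VarLp E p) : ∫ ω, ‖φ ω‖ ∂P ≤ 2 * ‖φ‖ := by
  rw [mul_comm, ← div_le_iff₀ two_pos]
  refine le_of_forall_gt_imp_ge_of_dense fun l hl => ?_
  have hl0 : 0 < l := (norm_nonneg φ).trans_lt hl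
  have h1 : ∫ ω, ‖φ ω‖ ∂P ≤ ∫ ω, l * (1 + (‖φ ω‖ / l) ^ p ω) ∂P := by
    refine integral_mono φ.integrable.norm
      (((integrable_const 1).add (φ.integrable_div_rpow hl0)).const_mul l) fun ω => ?_
    have h2 := le_one_add_rpow (a := ‖φ ω‖ / l) (by positivity) (p.one_lt ω).le
    rw [div_le_iff₀ hl0] at h2
    dsimp only
    linarith
  rw [integral_const_mul, integral_add (integrable_const _) (φ.integrable_div_rpow hl0)] at h1
  have h3 := integral_le_one_of_norm_lt hl
  simp only [integral_const, probReal_univ, smul_eq_mul, mul_one] at h1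
  rw [div_le_iff₀ two_pos]
  nlinarith

/-- The embedding of `L^{p(·)}` into `L¹`. -/
noncomputable def toL1 : VarLp E p →L[ℝ] (Ω →₁[P] E) :=
  LinearMap.mkContinuous
    { toFun := fun φ => φ.integrable.toL1 _
      map_add' := fun φ ψ => by
        rw [← Integrable.toL1_add]
        exact (Integrable.toL1_eq_toL1_iff _ _ _ _).2 (coeFn_add φ ψ)
      map_smul' := fun c φ => by
        rw [RingHom.id_apply, ← Integrable.toL1_smul]
        exact (Integrable.toL1_eq_toL1_iff _ _ _ _).2 (coeFn_smul c φ) } 2 fun φ => by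
    refine le_trans (le_of_eq ?_) φ.integral_norm_le
    rw [L1.norm_eq_integral_norm]
    exact integral_congr_ae (by
      filter_upwards [φ.integrable.coeFn_toL1] with ω hω
      simp only [LinearMap.coe_mk, AddHom.coe_mk, hω])

theorem coeFn_toL1 (φ : VarLp E p) : ∀ᵐ ω ∂P, toL1 φ ω = φ ω :=
  φ.integrable.coeFn_toL1

/-- The mean value `∫ φ dP`, as a continuous linear map. -/
noncomputable def mean [CompleteSpace E] : VarLp E p →L[ℝ] E := L1.integralCLM.comp toL1

theorem mean_apply [CompleteSpace E] (φ : VarLp E p) : mean φ = ∫ ω, φ ω ∂P := by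
  refine Eq.trans ?_ (integral_congr_ae φ.coeFn_toL1)
  exact (L1.integral_eq _).symm.trans (L1.integral_eq_integral _)

/-- The Riesz–Fischer theorem: a Cauchy sequence converges in `L¹`, and its limit there is also the
limit in `L^{p(·)}`. -/
instance [CompleteSpace E] : CompleteSpace (VarLp E p) := by
  refine Metric.complete_of_cauchySeq_tendsto fun u hu => ?_
  obtain ⟨g, hg⟩ := cauchySeq_tendsto_of_complete
    ((toL1 (E := E) (p := p)).uniformContinuous.comp_cauchySeq hu)
  obtain ⟨ns, hns, hae⟩ := (tendstoInMeasure_of_tendsto_Lp hg).exists_seq_tendsto_ae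
  have hae' : ∀ᵐ ω ∂P, Tendsto (fun k => u (ns k) ω) atTop (𝓝 (g ω)) := by
    filter_upwards [hae, ae_all_iff.2 fun k => coeFn_toL1 (u (ns k))] with ω h1 h2
    simpa only [Function.comp_apply, h2] using h1
  -- Fatou's lemma along the almost everywhere convergent subsequence
  have key : ∀ ε > 0, ∃ N, ∀ n ≥ N,
      ∫⁻ ω, (‖u n ω - g ω‖ₑ / ENNReal.ofReal ε) ^ p ω ∂P ≤ 1 := by
    intro ε hε
    obtain ⟨N, hN⟩ := Metric.cauchySeq_iff.1 hu ε hε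
    refine ⟨N, fun n hn => ?_⟩
    have hm : ∀ k, AEMeasurable
        (fun ω => (‖u n ω - u (ns k) ω‖ₑ / ENNReal.ofReal ε) ^ p ω) P := fun k =>
      (((u n).aestronglyMeasurable.sub (u (ns k)).aestronglyMeasurable).enorm.div_const _).pow
        p.aemeasurable
    calc ∫⁻ ω, (‖u n ω - g ω‖ₑ / ENNReal.ofReal ε) ^ p ω ∂P
        = ∫⁻ ω, liminf (fun k => (‖u n ω - u (ns k) ω‖ₑ / ENNReal.ofReal ε) ^ p ω) atTop ∂P := by
          refine lintegral_congr_ae ?_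
          filter_upwards [hae'] with ω hω
          refine (Tendsto.liminf_eq ?_).symm
          refine ((ENNReal.continuous_rpow_const.tendsto _).comp
            (ENNReal.Tendsto.div_const ((tendsto_const_nhds.sub hω).enorm) (Or.inr ?_)))
          simpa using hε
      _ ≤ liminf (fun k => ∫⁻ ω, (‖u n ω - u (ns k) ω‖ₑ / ENNReal.ofReal ε) ^ p ω ∂P) atTop :=
          lintegral_liminf_le' hm
      _ ≤ 1 := by
          refine liminf_le_of_frequently_le' (Eventually.frequently ?_)
          filter_upwards [hns.tendsto_atTop.eventually_ge_atTop N] with k hk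
          have h1 := hN n hn (ns k) hk
          rw [dist_eq_norm] at h1
          refine (le_of_eq (lintegral_congr_ae ?_)).trans (lintegral_le_one_of_norm_lt h1)
          filter_upwards [coeFn_sub (u n) (u (ns k))] with ω hω
          rw [hω]
  obtain ⟨N, hN⟩ := key 1 one_pos
  have hgm : AEStronglyMeasurable (fun ω => u N ω - g ω) P :=
    (u N).aestronglyMeasurable.sub (Lp.aestronglyMeasurable g)
  have hgi : Integrable (fun ω => ‖u N ω - g ω‖ ^ p ω) P := by
    refine ⟨aestronglyMeasurable_norm_rpow hgm, ?_⟩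
    rw [hasFiniteIntegral_iff_enorm]
    simp only [enorm_norm_rpow (fun ω => u N ω - g ω)]
    have := hN N le_rfl
    simp only [ENNReal.ofReal_one, div_one] at this
    exact this.trans_lt ENNReal.one_lt_top
  refine ⟨u N - ofFun _ hgm hgi, Metric.tendsto_atTop.2 fun ε hε => ?_⟩
  obtain ⟨n₀, hn₀⟩ := key (ε / 2) (by linarith)
  refine ⟨n₀, fun n hn => ?_⟩
  rw [dist_eq_norm]
  refine (norm_le_of_lintegral_le_one (l := ε / 2) (by linarith) ?_).trans_lt (by linarith)
  refine (le_of_eq (lintegral_congr_ae ?_)).trans (hn₀ n hn)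
  filter_upwards [coeFn_sub (u n) (u N - ofFun _ hgm hgi), coeFn_sub (u N) (ofFun _ hgm hgi),
    coeFn_ofFun _ hgm hgi] with ω h1 h2 h3
  rw [h1, h2, h3, sub_sub_cancel]

/-- The constant function `ω ↦ c`. -/
noncomputable def const (c : E) : VarLp E p :=
  ofFun (fun _ => c) aestronglyMeasurable_const (by
    refine (integrable_const ((max 1 ‖c‖) ^ p.β)).mono'
      (aestronglyMeasurable_norm_rpow aestronglyMeasurable_const)
      (Eventually.of_forall fun ω => ?_)
    rw [Real.norm_of_nonneg (by positivity)]
    calc ‖c‖ ^ p ω ≤ (max 1 ‖c‖) ^ p ω :=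
          Real.rpow_le_rpow (norm_nonneg _) (le_max_right _ _) (p.pos ω).le
      _ ≤ _ := Real.rpow_le_rpow_of_exponent_le (le_max_left _ _) (p.le_β ω))

theorem coeFn_const (c : E) : ∀ᵐ ω ∂P, (const c : VarLp E p) ω = c :=
  coeFn_ofFun _ _ _

theorem const_sub (b c : E) : (const (b - c) : VarLp E p) = const b - const c := by
  refine ext_ae ?_
  filter_upwards [coeFn_const (p := p) (b - c), coeFn_const (p := p) b, coeFn_const (p := p) c,
    coeFn_sub (const b : VarLp E p) (const c)] with ω h1 h2 h3 h4
  rw [h1, h4, h2, h3]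

theorem norm_const_le (c : E) : ‖(const c : VarLp E p)‖ ≤ ‖c‖ := by
  refine le_of_forall_gt_imp_ge_of_dense fun l hl => ?_
  have hl0 : 0 < l := (norm_nonneg c).trans_lt hl
  refine norm_le_of_integral_le_one hl0 ?_
  calc ∫ ω, (‖(const c : VarLp E p) ω‖ / l) ^ p ω ∂P ≤ ∫ _, (1 : ℝ) ∂P := by
        refine integral_mono_ae (integrable_div_rpow _ hl0) (integrable_const _) ?_
        filter_upwards [coeFn_const (p := p) c] with ω hω
        rw [hω]
        exact Real.rpow_le_one (by positivity) ((div_le_one hl0).2 hl.le) (p.pos ω).le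
    _ = 1 := by simp

end Prob

/-! ### The duality pairing -/

section Pairing

variable {H : Type*} [NormedAddCommGroup H] [InnerProductSpace ℝ H]

theorem abs_inner_le_rpow_add_rpow (ω : Ω) (a b : H) :
    |inner ℝ a b| ≤ ‖a‖ ^ p.conj ω + ‖b‖ ^ p ω := by
  have h := mul_le_eps_rpow_add_rpow (norm_nonneg a) (norm_nonneg b)
    (p.holderConjugate ω).symm le_rfl one_pos le_rfl
  rw [Real.one_rpow, one_mul, one_mul] at h
  exact (abs_real_inner_le_norm a b).trans h

theorem integrable_inner (w : VarLp H p.conj) (x : VarLp H p) :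
    Integrable (fun ω => inner ℝ (w ω) (x ω)) P :=
  (w.integrable_rpow.add x.integrable_rpow).mono'
    (w.aestronglyMeasurable.inner x.aestronglyMeasurable)
    (Eventually.of_forall fun ω => abs_inner_le_rpow_add_rpow ω _ _)

theorem abs_integral_inner_le (w : VarLp H p.conj) (x : VarLp H p) :
    |∫ ω, inner ℝ (w ω) (x ω) ∂P| ≤ (w.modular + 1) * ‖x‖ := by
  have hw : 0 < w.modular + 1 := by linarith [w.modular_nonneg]
  rw [mul_comm, ← div_le_iff₀ hw]
  refine le_of_forall_gt_imp_ge_of_dense fun l hl => ?_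
  have hl0 : 0 < l := (norm_nonneg x).trans_lt hl
  have hi := x.integrable_div_rpow hl0
  rw [div_le_iff₀ hw]
  calc |∫ ω, inner ℝ (w ω) (x ω) ∂P| ≤ ∫ ω, |inner ℝ (w ω) (x ω)| ∂P :=
        abs_integral_le_integral_abs
    _ ≤ ∫ ω, l * (‖w ω‖ ^ p.conj ω + (‖x ω‖ / l) ^ p ω) ∂P := by
        refine integral_mono (integrable_inner w x).abs
          ((w.integrable_rpow.add hi).const_mul l) fun ω => ?_
        have h := abs_inner_le_rpow_add_rpow (p := p) ω (w ω) (l⁻¹ • x ω)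
        rw [norm_smul, inner_smul_right, abs_mul, Real.norm_of_nonneg (by positivity),
          abs_of_nonneg (by positivity), inv_mul_eq_div, inv_mul_eq_div, div_le_iff₀ hl0] at h
        dsimp only
        linarith
    _ = l * (w.modular + ∫ ω, (‖x ω‖ / l) ^ p ω ∂P) := by
        rw [integral_const_mul, integral_add w.integrable_rpow hi, modular]
    _ ≤ l * (w.modular + 1) := by gcongr; exact integral_le_one_of_norm_lt hl

/-- Hölder's inequality, with the constant `2` that comes from applying Young's inequality to the
normalized functions. -/
theorem abs_integral_inner_le_norm_mul_norm (w : VarLp H p.conj) (x : VarLp H p) :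
    |∫ ω, inner ℝ (w ω) (x ω) ∂P| ≤ 2 * ‖w‖ * ‖x‖ := by
  have hle : ∀ l > ‖w‖, |∫ ω, inner ℝ (w ω) (x ω) ∂P| ≤ 2 * l * ‖x‖ := by
    intro l hl
    have hl0 : 0 < l := (norm_nonneg w).trans_lt hl
    have h1 : ∫ ω, inner ℝ (w ω) (x ω) ∂P = l * ∫ ω, inner ℝ ((l⁻¹ • w) ω) (x ω) ∂P := by
      rw [← integral_const_mul]
      refine integral_congr_ae ?_
      filter_upwards [coeFn_smul l⁻¹ w] with ω hω
      rw [hω, real_inner_smul_left, mul_inv_cancel_left₀ hl0.ne']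
    have h2 : (l⁻¹ • w).modular ≤ 1 := by
      rw [modular, integral_congr_ae (ae_norm_div_rpow w hl0)]
      exact integral_le_one_of_norm_lt hl
    have h3 := abs_integral_inner_le (l⁻¹ • w) x
    rw [h1, abs_mul, abs_of_pos hl0]
    calc _ ≤ l * (((l⁻¹ • w).modular + 1) * ‖x‖) := by gcongr
      _ ≤ l * ((1 + 1) * ‖x‖) := by gcongr
      _ = _ := by ring
  have hc : Continuous fun l : ℝ => 2 * l * ‖x‖ := by fun_prop
  exact ge_of_tendsto (hc.continuousWithinAt (s := Set.Ioi ‖w‖))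
    (eventually_nhdsWithin_of_forall hle)

/-- The duality pairing `(w, x) ↦ ∫ w · x dP` of `L^{p'(·)}` and `L^{p(·)}`. -/
noncomputable def pairing : VarLp H p.conj →L[ℝ] VarLp H p →L[ℝ] ℝ :=
  LinearMap.mkContinuous₂
    (LinearMap.mk₂ ℝ (fun w x => ∫ ω, inner ℝ (w ω) (x ω) ∂P)
      (fun w z x => by
        rw [← integral_add (integrable_inner w x) (integrable_inner z x)]
        refine integral_congr_ae ?_
        filter_upwards [coeFn_add w z] with ω hω
        rw [hω, inner_add_left])
      (fun c w x => by
        rw [smul_eq_mul, ← integral_const_mul]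
        refine integral_congr_ae ?_
        filter_upwards [coeFn_smul c w] with ω hω
        rw [hω, real_inner_smul_left])
      (fun w x y => by
        rw [← integral_add (integrable_inner w x) (integrable_inner w y)]
        refine integral_congr_ae ?_
        filter_upwards [coeFn_add x y] with ω hω
        rw [hω, inner_add_right])
      fun c w x => by
        rw [smul_eq_mul, ← integral_const_mul]
        refine integral_congr_ae ?_
        filter_upwards [coeFn_smul c x] with ω hω
        rw [hω, inner_smul_right]) 2 abs_integral_inner_le_norm_mul_norm

theorem pairing_apply (w : VarLp H p.conj) (x : VarLp H p) :
    pairing w x = ∫ ω, inner ℝ (w ω) (x ω) ∂P := rfl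

theorem abs_pairing_le (w : VarLp H p.conj) (x : VarLp H p) :
    |pairing w x| ≤ 2 * ‖w‖ * ‖x‖ :=
  abs_integral_inner_le_norm_mul_norm w x

theorem pairing_const [IsProbabilityMeasure P] [CompleteSpace H] (w : VarLp H p.conj) (c : H) :
    pairing w (const c) = inner ℝ (∫ ω, w ω ∂P) c := by
  rw [pairing_apply, real_inner_comm, ← integral_inner w.integrable]
  refine integral_congr_ae ?_
  filter_upwards [coeFn_const (p := p) c] with ω hω
  rw [hω, real_inner_comm]

end Pairing

/-! ### Uniform convexity of the modular -/

theorem exists_dist_le_of_modular_midpoint [StrictConvexSpace ℝ E] [FiniteDimensional ℝ E]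
    (M : ℝ) {ε : ℝ} (hε : 0 < ε) :
    ∃ δ > 0, ∀ x y : VarLp E p, x.modular ≤ M → y.modular ≤ M →
      (x.modular + y.modular) / 2 - ((2 : ℝ)⁻¹ • (x + y)).modular < δ → dist x y ≤ ε := by
  set r := min ε 1 with hr
  have hr0 : 0 < r := lt_min hε one_pos
  set M' := max M 1 with hM'
  have hM1 : 1 ≤ M' := le_max_right _ _
  set η := min 1 (r ^ p.β / (4 * M')) with hη
  have hrβ : 0 < r ^ p.β := by positivity
  have hη0 : 0 < η := lt_min one_pos (by positivity)
  obtain ⟨C, hC, h⟩ := exists_norm_sub_rpow_le_convexityGap (E := E) (β := p.β) p.one_lt_α hη0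
    (min_le_left _ _)
  refine ⟨r ^ p.β / (2 * C), by positivity, fun x y hx hy hxy => ?_⟩
  rw [dist_eq_norm]
  refine (norm_le_of_modular_le hr0 (min_le_right _ _) ?_).trans (min_le_left _ _)
  have hix := x.integrable_rpow
  have hiy := y.integrable_rpow
  have hiz := ((2 : ℝ)⁻¹ • (x + y)).integrable_rpow
  have hs : Integrable (fun ω => ‖x ω‖ ^ p ω + ‖y ω‖ ^ p ω) P := hix.add hiy
  have hg : Integrable (fun ω => (‖x ω‖ ^ p ω + ‖y ω‖ ^ p ω) / 2 -
      ‖((2 : ℝ)⁻¹ • (x + y)) ω‖ ^ p ω) P := (hs.div_const 2).sub hiz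
  have hle : (x - y).modular ≤ ∫ ω, (η * (‖x ω‖ ^ p ω + ‖y ω‖ ^ p ω) +
      C * ((‖x ω‖ ^ p ω + ‖y ω‖ ^ p ω) / 2 - ‖((2 : ℝ)⁻¹ • (x + y)) ω‖ ^ p ω)) ∂P := by
    refine integral_mono_ae (x - y).integrable_rpow ((hs.const_mul _).add (hg.const_mul _)) ?_
    filter_upwards [coeFn_sub x y, coeFn_smul (2 : ℝ)⁻¹ (x + y), coeFn_add x y] with ω h1 h2 h3
    rw [h1, h2, h3]
    exact h (p ω) (p.α_le ω) (p.le_β ω) _ _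
  rw [integral_add (hs.const_mul _) (hg.const_mul _), integral_const_mul, integral_const_mul,
    integral_sub (hs.div_const 2) hiz, integral_div, integral_add hix hiy] at hle
  change _ ≤ η * (x.modular + y.modular) +
    C * ((x.modular + y.modular) / 2 - ((2 : ℝ)⁻¹ • (x + y)).modular) at hle
  have h1 : η * (x.modular + y.modular) ≤ r ^ p.β / 2 := by
    calc η * (x.modular + y.modular) ≤ r ^ p.β / (4 * M') * (M' + M') := by
          have := x.modular_nonneg
          have := y.modular_nonneg
          gcongr
          · exact min_le_right _ _
          · exact hx.trans (le_max_left _ _)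
          · exact hy.trans (le_max_left _ _)
      _ = r ^ p.β / 2 := by field_simp; ring
  have h2 : C * ((x.modular + y.modular) / 2 - ((2 : ℝ)⁻¹ • (x + y)).modular) ≤ r ^ p.β / 2 := by
    calc _ ≤ C * (r ^ p.β / (2 * C)) := by gcongr
      _ = _ := by field_simp
  linarith

end VarLp

/-! ### Carathéodory functions and generalized dominated convergence -/

theorem aestronglyMeasurable_comp_of_caratheodory {Ω X Y : Type*} [MeasurableSpace Ω]
    {P : Measure Ω} [TopologicalSpace X] [NormedAddCommGroup Y] {F : Ω → X → Y}
    (hF : ∀ x, AEStronglyMeasurable (fun ω => F ω x) P) (hc : ∀ᵐ ω ∂P, Continuous (F ω))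
    {u : Ω → X} (hu : AEStronglyMeasurable u P) :
    AEStronglyMeasurable (fun ω => F ω (u ω)) P := by
  have hsimple : ∀ s : SimpleFunc Ω X, AEStronglyMeasurable (fun ω => F ω (s ω)) P := by
    classical
    intro s
    have h : (fun ω => F ω (s ω)) =
        ∑ y ∈ s.range, (s ⁻¹' {y}).indicator fun ω => F ω y := by
      ext ω
      rw [Finset.sum_apply, Finset.sum_eq_single (s ω)]
      · simp
      · intro y _ hy
        exact Set.indicator_of_notMem (by simpa using hy.symm) _
      · intro h
        exact absurd (s.mem_range_self ω) h
    rw [h]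
    exact Finset.aestronglyMeasurable_sum _ fun y _ =>
      (hF y).indicator (s.measurableSet_fiber y)
  refine aestronglyMeasurable_of_tendsto_ae (u := atTop)
    (fun n => hsimple (hu.stronglyMeasurable_mk.approx n)) ?_
  filter_upwards [hc, hu.ae_eq_mk] with ω h1 h2
  rw [h2]
  exact (h1.tendsto _).comp (hu.stronglyMeasurable_mk.tendsto_approx ω)

/-- Dominated convergence where the dominating function may contain a part tending to zero in `L¹`. -/
theorem tendsto_integral_zero_of_le_add {Ω : Type*} [MeasurableSpace Ω] {P : Measure Ω}
    {f g : ℕ → Ω → ℝ} {H : Ω → ℝ} {D : ℝ} (hf : ∀ n, Integrable (f n) P)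
    (hf0 : ∀ n ω, 0 ≤ f n ω) (hg : ∀ n, Integrable (g n) P) (hH : Integrable H P)
    (hH0 : ∀ ω, 0 ≤ H ω) (hle : ∀ n, ∀ᵐ ω ∂P, f n ω ≤ D * g n ω + H ω)
    (hD : ∀ n, ∀ᵐ ω ∂P, 0 ≤ D * g n ω) (hgt : Tendsto (fun n => ∫ ω, g n ω ∂P) atTop (𝓝 0))
    (hft : ∀ᵐ ω ∂P, Tendsto (fun n => f n ω) atTop (𝓝 0)) :
    Tendsto (fun n => ∫ ω, f n ω ∂P) atTop (𝓝 0) := by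
  have h1 : Tendsto (fun n => ∫ ω, min (f n ω) (H ω) ∂P) atTop (𝓝 (∫ _, (0 : ℝ) ∂P)) := by
    refine tendsto_integral_of_dominated_convergence H
      (fun n => ((hf n).inf hH).aestronglyMeasurable) hH
      (fun n => Eventually.of_forall fun ω => ?_) ?_
    · rw [Real.norm_of_nonneg (le_min (hf0 n ω) (hH0 ω))]
      exact min_le_right _ _
    · filter_upwards [hft] with ω hω
      have := hω.min (tendsto_const_nhds (x := H ω))
      rwa [min_eq_left (hH0 ω)] at this
  rw [integral_zero] at h1
  have h2 := h1.add (hgt.const_mul D)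
  rw [mul_zero, add_zero] at h2
  refine squeeze_zero (fun n => integral_nonneg (hf0 n)) (fun n => ?_) h2
  have hi : Integrable (fun ω => min (f n ω) (H ω)) P := (hf n).inf hH
  rw [← integral_const_mul, ← integral_add hi ((hg n).const_mul D)]
  refine integral_mono_ae (hf n) (hi.add ((hg n).const_mul D)) ?_
  filter_upwards [hle n, hD n] with ω h3 h4
  rcases le_total (f n ω) (H ω) with h | h
  · simp only [min_eq_left h]
    linarith
  · simp only [min_eq_right h]
    linarith

/-! ### The Nemytskii operator of an admissible tensor -/

namespace IsAdmissible

variable {Ω : Type*} [MeasurableSpace Ω] {P : Measure Ω}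
variable {d : ℕ} {p : VariableExponent P} {A : Ω → SymMat d → SymMat d}

theorem monotone (hA : IsAdmissible p A) (ω : Ω) (a b : SymMat d) :
    0 ≤ inner ℝ (A ω a - A ω b) (a - b) := by
  rcases eq_or_ne a b with rfl | h
  · simp
  · exact (hA.strictMono ω a b h).le

/-- Coercivity around an arbitrary point `b` instead of the origin. -/
theorem exists_rpow_le_inner (hA : IsAdmissible p A) :
    ∃ c > 0, ∃ K ≥ 0, ∀ ω a b,
      c * ‖a‖ ^ p ω ≤ inner ℝ (A ω a) (a - b) + K * (‖b‖ ^ p ω + 1) := by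
  obtain ⟨c₀, hc₀, hco⟩ := hA.coercive
  obtain ⟨c₁, hc₁, hgr⟩ := hA.growth
  -- the growth term of Young's inequality is absorbed by half of the coercivity
  set ε := min 1 (c₀ / (2 * c₁)) with hε
  have hε0 : 0 < ε := lt_min one_pos (by positivity)
  have hεc : ε * c₁ ≤ c₀ / 2 := by
    calc ε * c₁ ≤ c₀ / (2 * c₁) * c₁ := by gcongr; exact min_le_right _ _
      _ = c₀ / 2 := by field_simp
  have hεβ : 0 < ε ^ (-p.β) := by positivity
  refine ⟨c₀ / 2, by positivity, ε ^ (-p.β) + c₀⁻¹ + c₀ / 2, by positivity, fun ω a b => ?_⟩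
  have h1 := hco ω a
  have h2 := hgr ω a
  have h3 := mul_le_eps_rpow_add_rpow (norm_nonneg (A ω a)) (norm_nonneg b)
    (p.holderConjugate ω).symm (p.le_β ω) hε0 (min_le_left _ _)
  have h4 := real_inner_le_norm (A ω a) b
  have h5 : ε * ‖A ω a‖ ^ p.conj ω ≤ c₀ / 2 * (‖a‖ ^ p ω + 1) := by
    calc ε * ‖A ω a‖ ^ p.conj ω ≤ ε * (c₁ * ‖a‖ ^ p ω + c₁) := by gcongr
      _ = ε * c₁ * (‖a‖ ^ p ω + 1) := by ring
      _ ≤ _ := by gcongr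
  have h6 : 0 ≤ (c₀⁻¹ + c₀ / 2) * ‖b‖ ^ p ω := by positivity
  rw [inner_sub_right]
  nlinarith

/-- The monotonicity term controls `‖a‖ ^ p`. This replaces any equi-integrability argument in the
strong convergence of fluxes. -/
theorem exists_rpow_le_inner_sub (hA : IsAdmissible p A) :
    ∃ c > 0, ∃ K ≥ 0, ∀ ω a b,
      c * ‖a‖ ^ p ω ≤ inner ℝ (A ω a - A ω b) (a - b) + K * (‖b‖ ^ p ω + 1) := by
  obtain ⟨c, hc, K, hK, h⟩ := hA.exists_rpow_le_inner
  obtain ⟨c₁, hc₁, hgr⟩ := hA.growth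
  set ε := min 1 (c / 2) with hε
  have hε0 : 0 < ε := lt_min one_pos (by positivity)
  have hεc : ε ≤ c / 2 := min_le_right _ _
  set M := ε ^ (-p.conj.β) with hM
  have hM0 : 0 < M := by positivity
  refine ⟨c / 2, by positivity, K + (M + 1) * c₁ + 1, by positivity, fun ω a b => ?_⟩
  have h1 := h ω a b
  have h2 := hgr ω b
  have h3 := mul_le_eps_rpow_add_rpow (norm_nonneg a) (norm_nonneg (A ω b))
    (p.holderConjugate ω) (p.conj.le_β ω) hε0 (min_le_left _ _)
  have h4 := VarLp.abs_inner_le_rpow_add_rpow (p := p) ω (A ω b) b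
  have h5 := real_inner_le_norm a (A ω b)
  have h6 : ε * ‖a‖ ^ p ω ≤ c / 2 * ‖a‖ ^ p ω := by gcongr
  have h7 : (M + 1) * ‖A ω b‖ ^ p.conj ω ≤ (M + 1) * (c₁ * ‖b‖ ^ p ω + c₁) := by gcongr
  have h8 := neg_abs_le (inner ℝ (A ω b) b)
  rw [real_inner_comm] at h5
  simp only [inner_sub_left, inner_sub_right] at h1 ⊢
  nlinarith

theorem aestronglyMeasurable_comp (hA : IsAdmissible p A) (u : VarLp (SymMat d) p) :
    AEStronglyMeasurable (fun ω => A ω (u ω)) P :=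
  aestronglyMeasurable_comp_of_caratheodory hA.aestronglyMeasurable hA.continuous
    u.aestronglyMeasurable

variable [IsProbabilityMeasure P]

/-- The Nemytskii operator `u ↦ A(·, u(·))` from `L^{p(·)}` to `L^{p'(·)}`. -/
noncomputable def nemytskii (hA : IsAdmissible p A) (u : VarLp (SymMat d) p) :
    VarLp (SymMat d) p.conj :=
  VarLp.ofFun (fun ω => A ω (u ω)) (hA.aestronglyMeasurable_comp u) (by
    obtain ⟨c₁, hc₁, hgr⟩ := hA.growth
    refine ((u.integrable_rpow.const_mul c₁).add (integrable_const c₁)).mono'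
      (VarLp.aestronglyMeasurable_norm_rpow (hA.aestronglyMeasurable_comp u))
      (Eventually.of_forall fun ω => ?_)
    rw [Real.norm_of_nonneg (by positivity)]
    exact hgr ω _)

theorem coeFn_nemytskii (hA : IsAdmissible p A) (u : VarLp (SymMat d) p) :
    ∀ᵐ ω ∂P, hA.nemytskii u ω = A ω (u ω) :=
  VarLp.coeFn_ofFun _ _ _

theorem pairing_nemytskii (hA : IsAdmissible p A) (u x : VarLp (SymMat d) p) :
    VarLp.pairing (hA.nemytskii u) x = ∫ ω, inner ℝ (A ω (u ω)) (x ω) ∂P := by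
  refine integral_congr_ae ?_
  filter_upwards [hA.coeFn_nemytskii u] with ω hω
  rw [hω]

theorem ae_inner_nemytskii_sub (hA : IsAdmissible p A) (u v : VarLp (SymMat d) p) :
    ∀ᵐ ω ∂P, inner ℝ ((hA.nemytskii u - hA.nemytskii v) ω) ((u - v) ω) =
      inner ℝ (A ω (u ω) - A ω (v ω)) (u ω - v ω) := by
  filter_upwards [VarLp.coeFn_sub (hA.nemytskii u) (hA.nemytskii v), VarLp.coeFn_sub u v,
    hA.coeFn_nemytskii u, hA.coeFn_nemytskii v] with ω h1 h2 h3 h4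
  rw [h1, h2, h3, h4]

theorem pairing_nemytskii_sub_nonneg (hA : IsAdmissible p A) (u v : VarLp (SymMat d) p) :
    0 ≤ VarLp.pairing (hA.nemytskii u - hA.nemytskii v) (u - v) := by
  refine integral_nonneg_of_ae ?_
  filter_upwards [hA.ae_inner_nemytskii_sub u v] with ω hω
  rw [hω]
  exact hA.monotone ω _ _

theorem eq_of_pairing_nemytskii_sub_eq_zero (hA : IsAdmissible p A) {u v : VarLp (SymMat d) p}
    (h : VarLp.pairing (hA.nemytskii u - hA.nemytskii v) (u - v) = 0) : u = v := by
  have h0 : 0 ≤ᵐ[P] fun ω => inner ℝ ((hA.nemytskii u - hA.nemytskii v) ω) ((u - v) ω) := by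
    filter_upwards [hA.ae_inner_nemytskii_sub u v] with ω hω
    rw [hω]
    exact hA.monotone ω _ _
  have h1 := (integral_eq_zero_iff_of_nonneg_ae h0 (VarLp.integrable_inner _ _)).1 h
  refine VarLp.ext_ae ?_
  filter_upwards [h1, hA.ae_inner_nemytskii_sub u v] with ω h2 h3
  by_contra hne
  have h4 := hA.strictMono ω _ _ hne
  rw [← h3, h2] at h4
  exact lt_irrefl _ h4

theorem exists_modular_le_pairing (hA : IsAdmissible p A) :
    ∃ c > 0, ∃ K ≥ 0, ∀ u v : VarLp (SymMat d) p,
      c * u.modular ≤ VarLp.pairing (hA.nemytskii u) (u - v) + K * (v.modular + 1) := by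
  obtain ⟨c, hc, K, hK, h⟩ := hA.exists_rpow_le_inner
  refine ⟨c, hc, K, hK, fun u v => ?_⟩
  have hi := VarLp.integrable_inner (hA.nemytskii u) (u - v)
  have hv : Integrable (fun ω => ‖v ω‖ ^ p ω + 1) P :=
    v.integrable_rpow.add (integrable_const 1)
  have hle : ∫ ω, c * ‖u ω‖ ^ p ω ∂P ≤
      ∫ ω, (inner ℝ (hA.nemytskii u ω) ((u - v) ω) + K * (‖v ω‖ ^ p ω + 1)) ∂P := by
    refine integral_mono_ae (u.integrable_rpow.const_mul c) (hi.add (hv.const_mul K)) ?_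
    filter_upwards [hA.coeFn_nemytskii u, VarLp.coeFn_sub u v] with ω h1 h2
    rw [h1, h2]
    exact h ω _ _
  rw [integral_const_mul, integral_add hi (hv.const_mul K), integral_const_mul,
    integral_add v.integrable_rpow (integrable_const 1)] at hle
  simpa only [integral_const, probReal_univ, smul_eq_mul, mul_one, VarLp.modular,
    VarLp.pairing_apply] using hle

theorem exists_modular_nemytskii_le (hA : IsAdmissible p A) :
    ∃ c > 0, ∀ u : VarLp (SymMat d) p, (hA.nemytskii u).modular ≤ c * u.modular + c := by
  obtain ⟨c, hc, h⟩ := hA.growth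
  refine ⟨c, hc, fun u => ?_⟩
  have hle : (hA.nemytskii u).modular ≤ ∫ ω, (c * ‖u ω‖ ^ p ω + c) ∂P := by
    refine integral_mono_ae (hA.nemytskii u).integrable_rpow
      ((u.integrable_rpow.const_mul c).add (integrable_const c)) ?_
    filter_upwards [hA.coeFn_nemytskii u] with ω h1
    rw [h1]
    exact h ω _
  rw [integral_add (u.integrable_rpow.const_mul c) (integrable_const c),
    integral_const_mul] at hle
  simpa only [integral_const, probReal_univ, smul_eq_mul, one_mul, VarLp.modular] using hle

/-- A Leray–Lions argument: if the monotonicity term tends to zero in `L¹`, the fluxes converge in the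
norm of `L^{p'(·)}`. Strict monotonicity gives convergence almost everywhere along subsequences, and
the monotonicity term itself provides the domination. -/
theorem tendsto_nemytskii_of_tendsto_pairing (hA : IsAdmissible p A)
    {u : ℕ → VarLp (SymMat d) p} {v : VarLp (SymMat d) p}
    (h : Tendsto (fun n => VarLp.pairing (hA.nemytskii (u n) - hA.nemytskii v) (u n - v))
      atTop (𝓝 0)) :
    Tendsto (fun n => hA.nemytskii (u n)) atTop (𝓝 (hA.nemytskii v)) := by
  refine tendsto_of_subseq_tendsto fun ns hns => ?_
  set g : ℕ → Ω → ℝ := fun n ω =>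
    inner ℝ ((hA.nemytskii (u n) - hA.nemytskii v) ω) ((u n - v) ω) with hg
  have hgi : ∀ n, Integrable (g n) P := fun n => VarLp.integrable_inner _ _
  have hgeq : ∀ n, ∀ᵐ ω ∂P, g n ω = inner ℝ (A ω (u n ω) - A ω (v ω)) (u n ω - v ω) :=
    fun n => hA.ae_inner_nemytskii_sub _ _
  have hg0 : ∀ n, 0 ≤ᵐ[P] g n := fun n => by
    filter_upwards [hgeq n] with ω hω
    rw [hω]
    exact hA.monotone ω _ _
  have hgt : Tendsto (fun n => ∫ ω, g (ns n) ω ∂P) atTop (𝓝 0) := h.comp hns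
  have hmeas : TendstoInMeasure P (fun n => g (ns n)) atTop 0 := by
    refine tendstoInMeasure_of_tendsto_eLpNorm one_ne_zero
      (fun n => (hgi _).aestronglyMeasurable) aestronglyMeasurable_zero ?_
    have h1 : ∀ n, eLpNorm (g (ns n) - 0) 1 P = ENNReal.ofReal (∫ ω, g (ns n) ω ∂P) := by
      intro n
      rw [sub_zero, eLpNorm_one_eq_lintegral_enorm,
        ofReal_integral_eq_lintegral_ofReal (hgi _) (hg0 _)]
      refine lintegral_congr_ae ?_
      filter_upwards [hg0 (ns n)] with ω hω
      exact Real.enorm_of_nonneg hω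
    simp only [h1]
    simpa using ENNReal.tendsto_ofReal hgt
  obtain ⟨ms, hms, hae⟩ := hmeas.exists_seq_tendsto_ae
  refine ⟨ms, VarLp.tendsto_of_tendsto_modular ?_⟩
  obtain ⟨c, hc, K, hK, hle⟩ := hA.exists_rpow_le_inner_sub
  obtain ⟨c₁, hc₁, hgr⟩ := hA.growth
  set B : ℝ := 2 ^ p.conj.β with hB
  have hB0 : 0 < B := by positivity
  set w := fun k => u (ns (ms k)) with hw
  refine tendsto_integral_zero_of_le_add (g := fun k => g (ns (ms k))) (D := B * c₁ / c)
    (H := fun ω => B * c₁ / c * (K * (‖v ω‖ ^ p ω + 1)) +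
      (B * c₁ + B * (c₁ * ‖v ω‖ ^ p ω + c₁)))
    (fun k => VarLp.integrable_rpow _) (fun k ω => by positivity) (fun k => hgi _) ?_
    (fun ω => by positivity) (fun k => ?_) (fun k => ?_) (hgt.comp hms.tendsto_atTop) ?_
  · have := v.integrable_rpow
    fun_prop
  · filter_upwards [VarLp.coeFn_sub (hA.nemytskii (w k)) (hA.nemytskii v),
      hA.coeFn_nemytskii (w k), hA.coeFn_nemytskii v, hgeq (ns (ms k))] with ω h1 h2 h3 h4
    rw [h1, h2, h3, h4]
    have h5 := norm_sub_rpow_le (p.conj.one_lt ω).le (p.conj.le_β ω) (A ω (w k ω)) (A ω (v ω))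
    have h6 := hle ω (w k ω) (v ω)
    rw [mul_comm, ← le_div_iff₀ hc] at h6
    calc _ ≤ B * (‖A ω (w k ω)‖ ^ p.conj ω + ‖A ω (v ω)‖ ^ p.conj ω) := h5
      _ ≤ B * ((c₁ * ‖w k ω‖ ^ p ω + c₁) + (c₁ * ‖v ω‖ ^ p ω + c₁)) := by
          gcongr
          · exact hgr ω _
          · exact hgr ω _
      _ ≤ B * ((c₁ * ((inner ℝ (A ω (w k ω) - A ω (v ω)) (w k ω - v ω) +
            K * (‖v ω‖ ^ p ω + 1)) / c) + c₁) + (c₁ * ‖v ω‖ ^ p ω + c₁)) := by gcongr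
      _ = _ := by ring
  · filter_upwards [hg0 (ns (ms k))] with ω hω
    exact mul_nonneg (by positivity) hω
  · filter_upwards [hae, hA.continuous, ae_all_iff.2 hgeq, hA.coeFn_nemytskii v,
      ae_all_iff.2 fun k => hA.coeFn_nemytskii (w k),
      ae_all_iff.2 fun k => VarLp.coeFn_sub (hA.nemytskii (w k)) (hA.nemytskii v)]
      with ω h1 h2 h3 h4 h5 h6
    simp only [h3] at h1
    have h7 : Tendsto (fun k => w k ω) atTop (𝓝 (v ω)) :=
      tendsto_of_tendsto_inner_of_strictMono h2 (hA.strictMono ω) h1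
    have h8 : Tendsto (fun k => ‖A ω (w k ω) - A ω (v ω)‖) atTop (𝓝 0) := by
      have := (((h2.tendsto _).comp h7).sub_const (A ω (v ω))).norm
      simpa using this
    have h9 := h8.rpow_const (p := p.conj ω) (Or.inr (p.conj.pos ω).le)
    rw [Real.zero_rpow (p.conj.pos ω).ne'] at h9
    refine h9.congr fun k => ?_
    rw [← h5 k, ← h4, ← h6 k]

end IsAdmissible

/-! ### Continuity of the Nemytskii operator and the variational inequality -/

namespace IsAdmissible

variable {Ω : Type*} [MeasurableSpace Ω] {P : Measure Ω} [IsProbabilityMeasure P]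
variable {d : ℕ} {p : VariableExponent P} {A : Ω → SymMat d → SymMat d}

theorem exists_norm_nemytskii_le (hA : IsAdmissible p A) (M : ℝ) :
    ∃ C, ∀ u : VarLp (SymMat d) p, u.modular ≤ M → ‖hA.nemytskii u‖ ≤ C := by
  obtain ⟨c, hc, h⟩ := hA.exists_modular_nemytskii_le
  refine ⟨max 1 (c * M + c), fun u hu => (VarLp.norm_le_max_one_modular _).trans ?_⟩
  gcongr
  exact (h u).trans (by gcongr)

/-- The images of bounded sets are bounded, so the monotonicity term of a convergent sequence tends to
zero and the Leray–Lions argument applies. -/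
theorem continuous_nemytskii (hA : IsAdmissible p A) : Continuous hA.nemytskii := by
  refine continuous_iff_continuousAt.2 fun v => ?_
  refine tendsto_of_seq_tendsto fun u hu => hA.tendsto_nemytskii_of_tendsto_pairing ?_
  have hu0 : Tendsto (fun n => ‖u n - v‖) atTop (𝓝 0) := tendsto_iff_norm_sub_tendsto_zero.1 hu
  obtain ⟨C, hC⟩ := hA.exists_norm_nemytskii_le ((‖v‖ + 1) ^ p.β)
  refine squeeze_zero_norm' (a := fun n => 2 * (C + C) * ‖u n - v‖) ?_
    (by simpa using hu0.const_mul (2 * (C + C)))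
  filter_upwards [hu0.eventually_lt_const one_pos] with n hn
  have h1 : ‖u n‖ < ‖v‖ + 1 := by
    have := norm_le_norm_add_norm_sub' (u n) v
    linarith
  have h2 := hC (u n) (VarLp.modular_le_of_norm_lt (by linarith [norm_nonneg v]) h1)
  have h3 := hC v (VarLp.modular_le_of_norm_lt (by linarith [norm_nonneg v]) (by linarith))
  refine (VarLp.abs_pairing_le _ _).trans ?_
  gcongr
  exact (norm_sub_le _ _).trans (by linarith)

/-- The Browder–Minty theorem for the Nemytskii operator on a translate `z + G` of a closed
subspace. -/
theorem exists_pairing_nemytskii_eq_zero (hA : IsAdmissible p A) (z : VarLp (SymMat d) p)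
    {G : Submodule ℝ (VarLp (SymMat d) p)} (hG : IsClosed (G : Set (VarLp (SymMat d) p))) :
    ∃ v ∈ G, ∀ θ ∈ G, VarLp.pairing (hA.nemytskii (z + v)) θ = 0 := by
  obtain ⟨c, hc, K, hK, hco⟩ := hA.exists_modular_le_pairing
  set m := max 1 (K * (z.modular + 1) / c) + ‖z‖ with hm
  have hm0 : 0 ≤ m := by positivity
  set R := m + 1 with hR
  set S : Set (VarLp (SymMat d) p) := (G : Set (VarLp (SymMat d) p)) ∩ Metric.closedBall 0 R
  have hSmem : ∀ x, x ∈ S ↔ x ∈ G ∧ ‖x‖ ≤ R := fun x => by simp [S]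
  have hSc : IsClosed S := hG.inter Metric.isClosed_closedBall
  have hSconv : Convex ℝ S := G.convex.inter (convex_closedBall _ _)
  have h0S : (0 : VarLp (SymMat d) p) ∈ S := (hSmem 0).2 ⟨G.zero_mem, by rw [norm_zero]; linarith⟩
  have hbd : ∀ x ∈ S, x.modular ≤ (R + 1) ^ p.β := fun x hx =>
    VarLp.modular_le_of_norm_lt (by linarith) (by linarith [((hSmem x).1 hx).2])
  set T : VarLp (SymMat d) p → VarLp (SymMat d) p →L[ℝ] ℝ :=
    fun x => VarLp.pairing (hA.nemytskii (z + x)) with hT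
  have hTc : Continuous T :=
    VarLp.pairing.continuous.comp (hA.continuous_nemytskii.comp (continuous_const.add continuous_id))
  obtain ⟨x, hx, hxy⟩ := exists_variationalInequality (T := T) VarLp.modular_nonneg hbd
    (fun ε hε => by
      obtain ⟨δ, hδ, h⟩ := VarLp.exists_dist_le_of_modular_midpoint (p := p) (E := SymMat d)
        ((R + 1) ^ p.β) hε
      exact ⟨δ, hδ, fun x hx y hy => h x y (hbd x hx) (hbd y hy)⟩) hSc hSconv ⟨0, h0S⟩
    (fun x _ y _ => by
      have := hA.pairing_nemytskii_sub_nonneg (z + x) (z + y)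
      rwa [add_sub_add_left_eq_sub, map_sub VarLp.pairing] at this)
  -- Minty's argument: test with points of the segment from `x` to `y` near `x`
  have hmin : ∀ y ∈ S, 0 ≤ T x (y - x) := by
    intro y hy
    have ht : Tendsto (fun n : ℕ => T (x + ((n : ℝ) + 1)⁻¹ • (y - x)) (y - x)) atTop
        (𝓝 (T x (y - x))) := by
      have h1 : Tendsto (fun n : ℕ => x + ((n : ℝ) + 1)⁻¹ • (y - x)) atTop (𝓝 x) := by
        have := (tendsto_one_div_add_atTop_nhds_zero_nat (𝕜 := ℝ)).smul_const (y - x)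
        simpa using this.const_add x
      have hev : Continuous fun v => T v (y - x) := hTc.clm_apply continuous_const
      exact (hev.tendsto x).comp h1
    refine ge_of_tendsto' ht fun n => ?_
    have hn : (0 : ℝ) < ((n : ℝ) + 1)⁻¹ := by positivity
    have h1 := hxy (x + ((n : ℝ) + 1)⁻¹ • (y - x))
      (hSconv.add_smul_sub_mem hx hy
        ⟨hn.le, inv_le_one_of_one_le₀ (by linarith [n.cast_nonneg (α := ℝ)])⟩)
    rw [add_sub_cancel_left, map_smul, smul_eq_mul] at h1
    exact nonneg_of_mul_nonneg_right h1 hn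
  -- coercivity bounds `x` by `m < R`, so that all directions of `G` are admissible at `x`
  have hxm : ‖x‖ ≤ m := by
    have h1 := hmin 0 h0S
    rw [zero_sub, map_neg] at h1
    have h2 := hco (z + x) z
    rw [add_sub_cancel_left] at h2
    have h3 : (z + x).modular ≤ K * (z.modular + 1) / c := by
      rw [le_div_iff₀ hc]
      change 0 ≤ -(VarLp.pairing (hA.nemytskii (z + x)) x) at h1
      linarith
    have h4 := (VarLp.norm_le_max_one_modular (z + x)).trans (max_le_max le_rfl h3)
    have h5 : ‖x‖ ≤ ‖z + x‖ + ‖z‖ := by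
      simpa using norm_sub_le (z + x) z
    linarith
  have hpos : ∀ θ ∈ G, 0 ≤ T x θ := by
    intro θ hθ
    have hs : 0 < (‖θ‖ + 1)⁻¹ := by positivity
    have h1 : ‖(‖θ‖ + 1)⁻¹ • θ‖ ≤ 1 := by
      rw [norm_smul, Real.norm_of_nonneg hs.le, inv_mul_le_one₀ (by positivity)]
      linarith
    have h2 := hmin (x + (‖θ‖ + 1)⁻¹ • θ) ((hSmem _).2
      ⟨G.add_mem ((hSmem x).1 hx).1 (G.smul_mem _ hθ),
        by linarith [norm_add_le x ((‖θ‖ + 1)⁻¹ • θ)]⟩)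
    rw [add_sub_cancel_left, map_smul, smul_eq_mul] at h2
    exact nonneg_of_mul_nonneg_right h2 hs
  refine ⟨x, ((hSmem x).1 hx).1, fun θ hθ => le_antisymm ?_ (hpos θ hθ)⟩
  have := hpos (-θ) (G.neg_mem hθ)
  rw [map_neg] at this
  exact neg_nonneg.1 this

end IsAdmissible

/-! ### The space of solenoidal strains -/

section Strains

variable {Ω : Type*} [MeasurableSpace Ω] {P : Measure Ω} {d : ℕ}
variable {τ : EuclideanSpace ℝ (Fin d) → Ω → Ω}

theorem HasGeneratorDeriv.add (hτ : ∀ y, MeasurePreserving (τ y) P P) {i : Fin d}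
    {φ ψ φ' ψ' : Lp ℝ 2 P} (h : HasGeneratorDeriv P τ i φ ψ)
    (h' : HasGeneratorDeriv P τ i φ' ψ') :
    HasGeneratorDeriv P τ i (φ + φ') (ψ + ψ') := by
  have hs := Tendsto.add h h'
  rw [add_zero] at hs
  refine tendsto_of_tendsto_of_tendsto_of_le_of_le tendsto_const_nhds hs
    (fun _ => zero_le) fun t => ?_
  have hm : ∀ φ ψ : Lp ℝ 2 P, AEStronglyMeasurable
      (fun ω => t⁻¹ * (φ (τ (EuclideanSpace.single i t) ω) - φ ω) - ψ ω) P := fun φ ψ =>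
    ((((Lp.aestronglyMeasurable φ).comp_measurePreserving (hτ _)).sub
      (Lp.aestronglyMeasurable φ)).const_mul _).sub (Lp.aestronglyMeasurable ψ)
  refine le_trans (le_of_eq (eLpNorm_congr_ae ?_))
    (eLpNorm_add_le (hm φ ψ) (hm φ' ψ') (by norm_num))
  filter_upwards [Lp.coeFn_add φ φ', Lp.coeFn_add ψ ψ',
    (hτ (EuclideanSpace.single i t)).quasiMeasurePreserving.ae_eq (Lp.coeFn_add φ φ')]
    with ω h1 h2 h3
  simp only [Function.comp_apply, Pi.add_apply] at h1 h2 h3 ⊢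
  rw [h1, h2, h3]
  ring

theorem HasGeneratorDeriv.smul (hτ : ∀ y, MeasurePreserving (τ y) P P) {i : Fin d}
    {φ ψ : Lp ℝ 2 P} (h : HasGeneratorDeriv P τ i φ ψ) (c : ℝ) :
    HasGeneratorDeriv P τ i (c • φ) (c • ψ) := by
  have hs := ENNReal.Tendsto.const_mul (a := ‖c‖ₑ) h (Or.inr enorm_ne_top)
  rw [mul_zero] at hs
  refine hs.congr fun t => ?_
  rw [← eLpNorm_const_smul]
  refine eLpNorm_congr_ae ?_
  filter_upwards [Lp.coeFn_smul c φ, Lp.coeFn_smul c ψ,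
    (hτ (EuclideanSpace.single i t)).quasiMeasurePreserving.ae_eq (Lp.coeFn_smul c φ)]
    with ω h1 h2 h3
  simp only [Function.comp_apply, Pi.smul_apply, smul_eq_mul] at h1 h2 h3 ⊢
  rw [h1, h2, h3]
  ring

theorem HasGeneratorDeriv.zero (hτ : ∀ y, MeasurePreserving (τ y) P P) (i : Fin d) :
    HasGeneratorDeriv P τ i 0 0 := by
  refine tendsto_const_nhds.congr fun t => ?_
  rw [← eLpNorm_zero (ε := ℝ) (μ := P) (p := 2)]
  refine eLpNorm_congr_ae ?_
  filter_upwards [Lp.coeFn_zero ℝ 2 P,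
    (hτ (EuclideanSpace.single i t)).quasiMeasurePreserving.ae_eq (Lp.coeFn_zero ℝ 2 P)]
    with ω h1 h2
  simp only [Function.comp_apply, Pi.zero_apply] at h1 h2 ⊢
  rw [h1, h2]
  simp

theorem HasDerivsUpTo.add (hτ : ∀ y, MeasurePreserving (τ y) P P) {n : ℕ}
    {φ φ' : Lp ℝ 2 P} (h : HasDerivsUpTo P τ n φ) (h' : HasDerivsUpTo P τ n φ') :
    HasDerivsUpTo P τ n (φ + φ') := by
  induction n generalizing φ φ' with
  | zero => trivial
  | succ n ih =>
    intro i
    obtain ⟨ψ, h1, h2⟩ := h i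
    obtain ⟨ψ', h1', h2'⟩ := h' i
    exact ⟨ψ + ψ', h1.add hτ h1', ih h2 h2'⟩

theorem HasDerivsUpTo.smul (hτ : ∀ y, MeasurePreserving (τ y) P P) {n : ℕ}
    {φ : Lp ℝ 2 P} (h : HasDerivsUpTo P τ n φ) (c : ℝ) : HasDerivsUpTo P τ n (c • φ) := by
  induction n generalizing φ with
  | zero => trivial
  | succ n ih =>
    intro i
    obtain ⟨ψ, h1, h2⟩ := h i
    exact ⟨c • ψ, h1.smul hτ c, ih h2⟩

theorem HasDerivsUpTo.zero (hτ : ∀ y, MeasurePreserving (τ y) P P) (n : ℕ) :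
    HasDerivsUpTo P τ n 0 := by
  induction n with
  | zero => trivial
  | succ n ih => exact fun i => ⟨0, HasGeneratorDeriv.zero hτ i, ih⟩

/-- The space `𝒟^∞` as a submodule of `L²(Ω)`. -/
def smoothSubmodule (hτ : ∀ y, MeasurePreserving (τ y) P P) : Submodule ℝ (Lp ℝ 2 P) where
  carrier := smoothFunctions P τ
  zero_mem' := ⟨(memLp_congr_ae (Lp.coeFn_zero ℝ 2 P)).2 MemLp.zero',
    HasDerivsUpTo.zero hτ⟩
  add_mem' := fun {φ ψ} hφ hψ =>
    ⟨(memLp_congr_ae (Lp.coeFn_add φ ψ)).2 (hφ.1.add hψ.1),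
      fun n => (hφ.2 n).add hτ (hψ.2 n)⟩
  smul_mem' := fun c φ hφ =>
    ⟨(memLp_congr_ae (Lp.coeFn_smul c φ)).2 (hφ.1.const_smul c), fun n => (hφ.2 n).smul hτ c⟩

theorem symPart_add (M N : Fin d → Fin d → ℝ) :
    symPart (fun i j => M i j + N i j) = symPart M + symPart N := by
  ext ij
  simp only [symPart, Submodule.coe_add, PiLp.add_apply]
  ring

theorem symPart_smul (c : ℝ) (M : Fin d → Fin d → ℝ) :
    symPart (fun i j => c * M i j) = c • symPart M := by
  ext ij
  simp only [symPart, Submodule.coe_smul, PiLp.smul_apply, smul_eq_mul]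
  ring

/-- The solenoidal strains as a submodule of `L^{p(·)}`. -/
def solenoidalStrainsSubmodule (hτ : ∀ y, MeasurePreserving (τ y) P P) (p : VariableExponent P) :
    Submodule ℝ (VarLp (SymMat d) p) where
  carrier := solenoidalStrains τ p
  zero_mem' := by
    refine ⟨0, 0, fun j => (smoothSubmodule hτ).zero_mem,
      fun i j => HasGeneratorDeriv.zero hτ i, by simp, ?_⟩
    filter_upwards [VarLp.coeFn_zero (p := p) (E := SymMat d), Lp.coeFn_zero ℝ 2 P] with ω h1 h2
    have h3 : (fun i j => (0 : Fin d → Fin d → Lp ℝ 2 P) i j ω) = fun _ _ => (0 : ℝ) := by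
      ext i j
      exact h2
    rw [h1, h3]
    ext ij
    simp [symPart]
  add_mem' := by
    rintro g g' ⟨φ, D, h1, h2, h3, h4⟩ ⟨φ', D', h1', h2', h3', h4'⟩
    refine ⟨φ + φ', D + D', fun j => (smoothSubmodule hτ).add_mem (h1 j) (h1' j),
      fun i j => (h2 i j).add hτ (h2' i j), ?_, ?_⟩
    · simp only [Pi.add_apply, Finset.sum_add_distrib, h3, h3', add_zero]
    · filter_upwards [h4, h4', VarLp.coeFn_add g g',
        ae_all_iff.2 fun i => ae_all_iff.2 fun j => Lp.coeFn_add (D i j) (D' i j)]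
        with ω e1 e2 e3 e4
      rw [e3, e1, e2, ← symPart_add]
      congr 1
      ext i j
      exact (e4 i j).symm
  smul_mem' := by
    rintro c g ⟨φ, D, h1, h2, h3, h4⟩
    refine ⟨c • φ, c • D, fun j => (smoothSubmodule hτ).smul_mem c (h1 j),
      fun i j => (h2 i j).smul hτ c, ?_, ?_⟩
    · simp only [Pi.smul_apply, ← Finset.smul_sum, h3, smul_zero]
    · filter_upwards [h4, VarLp.coeFn_smul c g,
        ae_all_iff.2 fun i => ae_all_iff.2 fun j => Lp.coeFn_smul c (D i j)] with ω e1 e2 e3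
      rw [e2, e1, ← symPart_smul]
      congr 1
      ext i j
      exact (e3 i j).symm

/-- The space `𝒢(Ω)` as a submodule of `L^{p(·)}`. -/
noncomputable def strainSubmodule (hτ : ∀ y, MeasurePreserving (τ y) P P)
    (p : VariableExponent P) : Submodule ℝ (VarLp (SymMat d) p) :=
  (solenoidalStrainsSubmodule hτ p).topologicalClosure

theorem mem_strainSubmodule {hτ : ∀ y, MeasurePreserving (τ y) P P} {p : VariableExponent P}
    {v : VarLp (SymMat d) p} : v ∈ strainSubmodule hτ p ↔ v ∈ strainSpace τ p := Iff.rfl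

theorem zero_mem_strainSpace (hτ : ∀ y, MeasurePreserving (τ y) P P)
    {p : VariableExponent P} :
    (0 : VarLp (SymMat d) p) ∈ strainSpace τ p :=
  mem_strainSubmodule.1 (strainSubmodule hτ p).zero_mem

variable [IsProbabilityMeasure P]

/-- Stationarity makes every generator derivative a limit of differences with mean zero. -/
theorem HasGeneratorDeriv.integral_eq_zero (hτ : ∀ y, MeasurePreserving (τ y) P P) {i : Fin d}
    {φ ψ : Lp ℝ 2 P} (h : HasGeneratorDeriv P τ i φ ψ) : ∫ ω, ψ ω ∂P = 0 := by
  have hint : ∀ f : Lp ℝ 2 P, Integrable (fun ω => f ω) P := fun f =>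
    (Lp.memLp f).integrable (by norm_num)
  have hle : ∀ t : ℝ, ‖∫ ω, ψ ω ∂P‖ₑ ≤ eLpNorm
      (fun ω => t⁻¹ * (φ (τ (EuclideanSpace.single i t) ω) - φ ω) - ψ ω) 2 P := by
    intro t
    set y := EuclideanSpace.single i t
    have hφτ : Integrable (fun ω => φ (τ y ω)) P := (hτ y).integrable_comp_of_integrable (hint φ)
    have hd : Integrable (fun ω => t⁻¹ * (φ (τ y ω) - φ ω)) P :=
      (hφτ.sub (hint φ)).const_mul _
    have h1 : ∫ ω, φ (τ y ω) ∂P = ∫ ω, φ ω ∂P := by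
      have hm : AEStronglyMeasurable (fun ω => φ ω) (P.map (τ y)) := by
        rw [(hτ y).map_eq]
        exact Lp.aestronglyMeasurable φ
      have := integral_map (hτ y).measurable.aemeasurable hm
      rw [(hτ y).map_eq] at this
      exact this.symm
    have h2 : ∫ ω, (t⁻¹ * (φ (τ y ω) - φ ω) - ψ ω) ∂P = -∫ ω, ψ ω ∂P := by
      rw [integral_sub hd (hint ψ), integral_const_mul, integral_sub hφτ (hint φ), h1]
      simp
    calc ‖∫ ω, ψ ω ∂P‖ₑ = ‖∫ ω, (t⁻¹ * (φ (τ y ω) - φ ω) - ψ ω) ∂P‖ₑ := by rw [h2, enorm_neg]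
      _ ≤ ∫⁻ ω, ‖t⁻¹ * (φ (τ y ω) - φ ω) - ψ ω‖ₑ ∂P := enorm_integral_le_lintegral_enorm _
      _ = eLpNorm (fun ω => t⁻¹ * (φ (τ y ω) - φ ω) - ψ ω) 1 P :=
          eLpNorm_one_eq_lintegral_enorm.symm
      _ ≤ _ := eLpNorm_le_eLpNorm_of_exponent_le (by norm_num)
          (hd.sub (hint ψ)).aestronglyMeasurable
  have h0 := ge_of_tendsto' h hle
  exact enorm_eq_zero.1 (le_antisymm h0 zero_le)

theorem integral_eq_zero_of_mem_solenoidalStrains (hτ : ∀ y, MeasurePreserving (τ y) P P)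
    {p : VariableExponent P} {g : VarLp (SymMat d) p} (hg : g ∈ solenoidalStrains τ p) :
    ∫ ω, g ω ∂P = 0 := by
  obtain ⟨φ, D, -, h2, -, h4⟩ := hg
  have hint : ∀ f : Lp ℝ 2 P, Integrable (fun ω => f ω) P := fun f =>
    (Lp.memLp f).integrable (by norm_num)
  ext ij
  let L : SymMat d →L[ℝ] ℝ := (EuclideanSpace.proj ij).comp (symSubmodule d).subtypeL
  have h5 := L.integral_comp_comm g.integrable
  change L (∫ ω, g ω ∂P) = 0
  rw [← h5]
  have h6 : ∀ᵐ ω ∂P, L (g ω) = (D ij.1 ij.2 ω + D ij.2 ij.1 ω) / 2 := by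
    filter_upwards [h4] with ω hω
    rw [hω]
    rfl
  rw [integral_congr_ae h6, integral_div, integral_add (hint _) (hint _),
    (h2 _ _).integral_eq_zero hτ, (h2 _ _).integral_eq_zero hτ]
  simp

theorem integral_eq_zero_of_mem_strainSpace (hτ : ∀ y, MeasurePreserving (τ y) P P)
    {p : VariableExponent P} {v : VarLp (SymMat d) p} (hv : v ∈ strainSpace τ p) :
    ∫ ω, v ω ∂P = 0 := by
  have hcl : IsClosed {v : VarLp (SymMat d) p | VarLp.mean v = 0} :=
    isClosed_eq VarLp.mean.continuous continuous_const
  rw [← VarLp.mean_apply]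
  refine closure_minimal (fun g hg => ?_) hcl hv
  exact (VarLp.mean_apply g).trans (integral_eq_zero_of_mem_solenoidalStrains hτ hg)

end Strains

/-! ### Energies -/

section Energy

variable {Ω : Type*} [MeasurableSpace Ω] {P : Measure Ω}
variable {E : Type*} [NormedAddCommGroup E] [NormedSpace ℝ E] {p : VariableExponent P}

namespace VarLp

theorem integrable_rpow_div (φ : VarLp E p) : Integrable (fun ω => ‖φ ω‖ ^ p ω / p ω) P := by
  refine φ.integrable_rpow.mono'
    (φ.integrable_rpow.aemeasurable.div p.aemeasurable).aestronglyMeasurable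
    (Eventually.of_forall fun ω => ?_)
  have := p.pos ω
  rw [Real.norm_of_nonneg (by positivity)]
  exact div_le_self (by positivity) (p.one_lt ω).le

theorem integral_rpow_div_le_modular (φ : VarLp E p) :
    ∫ ω, ‖φ ω‖ ^ p ω / p ω ∂P ≤ φ.modular :=
  integral_mono φ.integrable_rpow_div φ.integrable_rpow fun ω =>
    div_le_self (by positivity) (p.one_lt ω).le

theorem modular_le_mul_integral_rpow_div (φ : VarLp E p) :
    φ.modular ≤ p.β * ∫ ω, ‖φ ω‖ ^ p ω / p ω ∂P := by
  rw [← integral_const_mul]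
  refine integral_mono φ.integrable_rpow (φ.integrable_rpow_div.const_mul _) fun ω => ?_
  have h0 := p.pos ω
  have h1 := p.le_β ω
  have h2 : ‖φ ω‖ ^ p ω = p ω * (‖φ ω‖ ^ p ω / p ω) := by field_simp
  dsimp only
  conv_lhs => rw [h2]
  gcongr

theorem ae_const_add [IsProbabilityMeasure P] (ξ : E) (v : VarLp E p) :
    ∀ᵐ ω ∂P, (const ξ + v : VarLp E p) ω = ξ + v ω := by
  filter_upwards [coeFn_add (const ξ) v, coeFn_const (p := p) ξ] with ω h1 h2
  rw [h1, h2]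

end VarLp

end Energy

/-! ### The cell problem -/

section CellProblem

variable {Ω : Type*} [MeasurableSpace Ω] {P : Measure Ω} [IsProbabilityMeasure P] {d : ℕ}
variable {τ : EuclideanSpace ℝ (Fin d) → Ω → Ω} {p : VariableExponent P}
variable {A : Ω → SymMat d → SymMat d}

theorem pairing_nemytskii_const_add (hA : IsAdmissible p A) (ξ : SymMat d)
    (v θ : VarLp (SymMat d) p) :
    VarLp.pairing (hA.nemytskii (VarLp.const ξ + v)) θ =
      ∫ ω, inner ℝ (A ω (ξ + v ω)) (θ ω) ∂P := by
  rw [hA.pairing_nemytskii]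
  refine integral_congr_ae ?_
  filter_upwards [VarLp.ae_const_add ξ v] with ω hω
  rw [hω]

theorem isCellSolution_iff (hτ : ∀ y, MeasurePreserving (τ y) P P) (hA : IsAdmissible p A)
    {ξ : SymMat d} {v : VarLp (SymMat d) p} :
    IsCellSolution τ p A ξ v ↔ v ∈ strainSubmodule hτ p ∧ ∀ θ ∈ strainSubmodule hτ p,
      VarLp.pairing (hA.nemytskii (VarLp.const ξ + v)) θ = 0 := by
  simp only [pairing_nemytskii_const_add, mem_strainSubmodule]
  rfl

theorem existsUnique_isCellSolution (hτ : ∀ y, MeasurePreserving (τ y) P P)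
    (hA : IsAdmissible p A) (ξ : SymMat d) : ∃! v, IsCellSolution τ p A ξ v := by
  obtain ⟨v, hv, h⟩ := hA.exists_pairing_nemytskii_eq_zero (VarLp.const ξ)
    (G := strainSubmodule hτ p) (Submodule.isClosed_topologicalClosure _)
  refine ⟨v, (isCellSolution_iff hτ hA).2 ⟨hv, h⟩, fun v' hv' => ?_⟩
  obtain ⟨hv', h'⟩ := (isCellSolution_iff hτ hA).1 hv'
  refine add_left_cancel (a := (VarLp.const ξ : VarLp (SymMat d) p))
    (hA.eq_of_pairing_nemytskii_sub_eq_zero ?_)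
  have hmem := (strainSubmodule hτ p).sub_mem hv' hv
  rw [add_sub_add_left_eq_sub, map_sub VarLp.pairing, sub_apply, h _ hmem, h' _ hmem, sub_zero]

variable (τ p A) in
/-- The total strain `ξ + v_ξ`. -/
noncomputable def totalStrain (ξ : SymMat d) : VarLp (SymMat d) p :=
  VarLp.const ξ + cellSolution τ p A ξ

theorem isCellSolution_cellSolution (hτ : ∀ y, MeasurePreserving (τ y) P P)
    (hA : IsAdmissible p A) (ξ : SymMat d) :
    IsCellSolution τ p A ξ (cellSolution τ p A ξ) :=
  Classical.epsilon_spec (existsUnique_isCellSolution hτ hA ξ).exists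

theorem pairing_totalStrain_eq_zero (hτ : ∀ y, MeasurePreserving (τ y) P P)
    (hA : IsAdmissible p A) (ξ : SymMat d) {θ : VarLp (SymMat d) p}
    (hθ : θ ∈ strainSubmodule hτ p) :
    VarLp.pairing (hA.nemytskii (totalStrain τ p A ξ)) θ = 0 :=
  ((isCellSolution_iff hτ hA).1 (isCellSolution_cellSolution hτ hA ξ)).2 θ hθ

theorem cellSolution_mem (hτ : ∀ y, MeasurePreserving (τ y) P P)
    (hA : IsAdmissible p A) (ξ : SymMat d) : cellSolution τ p A ξ ∈ strainSubmodule hτ p :=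
  (isCellSolution_cellSolution hτ hA ξ).1

theorem ae_nemytskii_totalStrain (hA : IsAdmissible p A) (ξ : SymMat d) :
    ∀ᵐ ω ∂P, hA.nemytskii (totalStrain τ p A ξ) ω = flux τ p A ξ ω := by
  filter_upwards [hA.coeFn_nemytskii (totalStrain τ p A ξ),
    VarLp.ae_const_add ξ (cellSolution τ p A ξ)] with ω h1 h2
  rw [h1, totalStrain, h2, flux]

theorem Aeff_eq_integral_nemytskii (hA : IsAdmissible p A) (ξ : SymMat d) :
    Aeff τ p A ξ = ∫ ω, hA.nemytskii (totalStrain τ p A ξ) ω ∂P :=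
  integral_congr_ae ((ae_nemytskii_totalStrain hA ξ).mono fun _ h => h.symm)

theorem inner_Aeff (hA : IsAdmissible p A) (ξ η : SymMat d) :
    inner ℝ (Aeff τ p A ξ) η =
      VarLp.pairing (hA.nemytskii (totalStrain τ p A ξ)) (VarLp.const η) := by
  rw [Aeff_eq_integral_nemytskii hA, VarLp.pairing_const]

/-- The Hill–Mandel identity: microscopic and macroscopic work coincide. -/
theorem pairing_sub_totalStrain (hτ : ∀ y, MeasurePreserving (τ y) P P)
    (hA : IsAdmissible p A) (ξ η : SymMat d) :
    VarLp.pairing (hA.nemytskii (totalStrain τ p A ξ) - hA.nemytskii (totalStrain τ p A η))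
        (totalStrain τ p A ξ - totalStrain τ p A η) =
      VarLp.pairing (hA.nemytskii (totalStrain τ p A ξ) - hA.nemytskii (totalStrain τ p A η))
        (VarLp.const (ξ - η)) := by
  have h1 : totalStrain τ p A ξ - totalStrain τ p A η =
      VarLp.const (ξ - η) + (cellSolution τ p A ξ - cellSolution τ p A η) := by
    rw [VarLp.const_sub, totalStrain, totalStrain]
    abel
  have hmem := (strainSubmodule hτ p).sub_mem (cellSolution_mem hτ hA ξ)
    (cellSolution_mem hτ hA η)
  rw [h1, map_add, map_sub VarLp.pairing, sub_apply, sub_apply,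
    pairing_totalStrain_eq_zero hτ hA ξ hmem, pairing_totalStrain_eq_zero hτ hA η hmem,
    sub_zero, add_zero]

theorem integral_totalStrain (hτ : ∀ y, MeasurePreserving (τ y) P P)
    (hA : IsAdmissible p A) (ξ : SymMat d) : ∫ ω, totalStrain τ p A ξ ω ∂P = ξ := by
  rw [totalStrain, integral_congr_ae (VarLp.ae_const_add ξ (cellSolution τ p A ξ)),
    integral_add (integrable_const _) (VarLp.integrable _),
    integral_eq_zero_of_mem_strainSpace hτ (cellSolution_mem hτ hA ξ)]
  simp

theorem inner_Aeff_sub_pos (hτ : ∀ y, MeasurePreserving (τ y) P P) (hA : IsAdmissible p A)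
    {ξ η : SymMat d} (h : ξ ≠ η) :
    0 < inner ℝ (Aeff τ p A ξ - Aeff τ p A η) (ξ - η) := by
  have h1 := pairing_sub_totalStrain hτ hA ξ η
  rw [inner_sub_left, inner_Aeff hA, inner_Aeff hA, ← sub_apply, ← map_sub VarLp.pairing, ← h1]
  refine (hA.pairing_nemytskii_sub_nonneg _ _).lt_of_ne fun h0 => h ?_
  rw [← integral_totalStrain hτ hA ξ, hA.eq_of_pairing_nemytskii_sub_eq_zero h0.symm,
    integral_totalStrain hτ hA η]

/-- The total strain is a quasi-minimizer of the modular. -/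
theorem exists_modular_totalStrain_le (hτ : ∀ y, MeasurePreserving (τ y) P P)
    (hA : IsAdmissible p A) : ∃ K ≥ 0, ∀ ξ : SymMat d, ∀ v ∈ strainSpace τ p,
      (totalStrain τ p A ξ).modular ≤ K * ((VarLp.const ξ + v).modular + 1) := by
  obtain ⟨c, hc, K, hK, h⟩ := hA.exists_modular_le_pairing
  refine ⟨K / c, by positivity, fun ξ v hv => ?_⟩
  have h1 := h (totalStrain τ p A ξ) (VarLp.const ξ + v)
  have hmem := (strainSubmodule hτ p).sub_mem (cellSolution_mem hτ hA ξ)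
    (mem_strainSubmodule.2 hv)
  have h2 : totalStrain τ p A ξ - (VarLp.const ξ + v) = cellSolution τ p A ξ - v :=
    add_sub_add_left_eq_sub _ _ _
  rw [h2, pairing_totalStrain_eq_zero hτ hA ξ hmem, zero_add] at h1
  rw [div_mul_eq_mul_div, le_div_iff₀ hc]
  linarith

/-- The flux depends continuously on the mean strain, even for the norm of `L^{p'(·)}`. -/
theorem continuous_nemytskii_totalStrain (hτ : ∀ y, MeasurePreserving (τ y) P P)
    (hA : IsAdmissible p A) : Continuous fun ξ => hA.nemytskii (totalStrain τ p A ξ) := by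
  obtain ⟨K, hK, hmod⟩ := exists_modular_totalStrain_le (τ := τ) hτ hA
  refine continuous_iff_continuousAt.2 fun ξ => ?_
  refine tendsto_of_seq_tendsto fun x hx => hA.tendsto_nemytskii_of_tendsto_pairing ?_
  have hx0 : Tendsto (fun n => ‖x n - ξ‖) atTop (𝓝 0) := tendsto_iff_norm_sub_tendsto_zero.1 hx
  obtain ⟨C, hC⟩ := hA.exists_norm_nemytskii_le (K * ((‖ξ‖ + 1) ^ p.β + 1))
  have hbd : ∀ η : SymMat d, ‖η‖ < ‖ξ‖ + 1 → ‖hA.nemytskii (totalStrain τ p A η)‖ ≤ C := by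
    intro η hη
    refine hC _ ((hmod η 0 (zero_mem_strainSpace hτ)).trans ?_)
    rw [add_zero]
    gcongr
    exact VarLp.modular_le_of_norm_lt (by linarith [norm_nonneg ξ])
      ((VarLp.norm_const_le η).trans_lt hη)
  refine squeeze_zero_norm' (a := fun n => 2 * (C + C) * ‖x n - ξ‖) ?_
    (by simpa using hx0.const_mul (2 * (C + C)))
  filter_upwards [hx0.eventually_lt_const one_pos] with n hn
  have h1 : ‖x n‖ < ‖ξ‖ + 1 := by
    have := norm_le_norm_add_norm_sub' (x n) ξ
    linarith
  have h2 := hbd _ h1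
  have h3 := hbd ξ (by linarith)
  rw [pairing_sub_totalStrain hτ hA]
  refine (VarLp.abs_pairing_le _ _).trans ?_
  gcongr
  · linarith [(norm_nonneg _).trans h3]
  · exact (norm_sub_le _ _).trans (by linarith)
  · exact VarLp.norm_const_le _

theorem continuous_Aeff (hτ : ∀ y, MeasurePreserving (τ y) P P) (hA : IsAdmissible p A) :
    Continuous (Aeff τ p A) := by
  have h : Aeff τ p A = fun ξ => VarLp.mean (hA.nemytskii (totalStrain τ p A ξ)) := by
    ext1 ξ
    rw [VarLp.mean_apply, Aeff_eq_integral_nemytskii hA]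
  rw [h]
  exact VarLp.mean.continuous.comp (continuous_nemytskii_totalStrain hτ hA)

theorem integral_norm_add_rpow_div_eq (ξ : SymMat d) (v : VarLp (SymMat d) p) :
    ∫ ω, ‖ξ + v ω‖ ^ p ω / p ω ∂P = ∫ ω, ‖(VarLp.const ξ + v : VarLp (SymMat d) p) ω‖ ^ p ω / p ω ∂P := by
  refine integral_congr_ae ?_
  filter_upwards [VarLp.ae_const_add ξ v] with ω hω
  rw [hω]

theorem minEnergy_le_modular {v : VarLp (SymMat d) p} (hv : v ∈ strainSpace τ p)
    (ξ : SymMat d) : minEnergy τ p ξ ≤ (VarLp.const ξ + v).modular := by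
  refine (csInf_le ⟨0, ?_⟩ (Set.mem_image_of_mem _ hv)).trans ?_
  · rintro _ ⟨v, -, rfl⟩
    refine integral_nonneg fun ω => ?_
    have := p.pos ω
    positivity
  · rw [integral_norm_add_rpow_div_eq]
    exact VarLp.integral_rpow_div_le_modular _

theorem le_minEnergy (hτ : ∀ y, MeasurePreserving (τ y) P P) {ξ : SymMat d} {c : ℝ}
    (h : ∀ v ∈ strainSpace τ p, c ≤ (VarLp.const ξ + v).modular) :
    c / p.β ≤ minEnergy τ p ξ := by
  refine le_csInf (Set.Nonempty.image _ ⟨0, zero_mem_strainSpace hτ⟩) ?_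
  rintro _ ⟨v, hv, rfl⟩
  dsimp only
  rw [integral_norm_add_rpow_div_eq, div_le_iff₀' (by linarith [p.one_lt_β])]
  exact (h v hv).trans (VarLp.modular_le_mul_integral_rpow_div _)

theorem exists_minEnergy_le_inner_Aeff (hτ : ∀ y, MeasurePreserving (τ y) P P)
    (hA : IsAdmissible p A) :
    ∃ c₀ : ℝ, 0 < c₀ ∧ ∀ ξ, c₀ * minEnergy τ p ξ - c₀⁻¹ ≤ inner ℝ (Aeff τ p A ξ) ξ := by
  obtain ⟨c₀, hc₀, h⟩ := hA.coercive
  refine ⟨c₀, hc₀, fun ξ => ?_⟩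
  set u := totalStrain τ p A ξ with hu
  have h1 : inner ℝ (Aeff τ p A ξ) ξ = VarLp.pairing (hA.nemytskii u) u := by
    rw [inner_Aeff hA, hu]
    conv_rhs => rw [totalStrain, map_add]
    rw [← totalStrain, pairing_totalStrain_eq_zero hτ hA ξ (cellSolution_mem hτ hA ξ), add_zero]
  have h2 : c₀ * u.modular - c₀⁻¹ ≤ VarLp.pairing (hA.nemytskii u) u := by
    have hle : ∫ ω, (c₀ * ‖u ω‖ ^ p ω - c₀⁻¹) ∂P ≤ VarLp.pairing (hA.nemytskii u) u := by
      refine integral_mono_ae ((u.integrable_rpow.const_mul c₀).sub (integrable_const _))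
        (VarLp.integrable_inner _ _) ?_
      filter_upwards [hA.coeFn_nemytskii u] with ω hω
      rw [hω]
      exact h ω _
    rw [integral_sub (u.integrable_rpow.const_mul c₀) (integrable_const _),
      integral_const_mul] at hle
    simpa only [integral_const, probReal_univ, one_smul, VarLp.modular] using hle
  have h3 : minEnergy τ p ξ ≤ u.modular := minEnergy_le_modular (cellSolution_mem hτ hA ξ) ξ
  have h4 : c₀ * minEnergy τ p ξ ≤ c₀ * u.modular := by gcongr
  linarith

theorem conjEnergy_Aeff_le (hτ : ∀ y, MeasurePreserving (τ y) P P)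
    (hA : IsAdmissible p A) (ξ : SymMat d) :
    conjEnergy τ p (Aeff τ p A ξ) ≤ (hA.nemytskii (totalStrain τ p A ξ)).modular := by
  have hmem : hA.nemytskii (totalStrain τ p A ξ) ∈
      {w | w ∈ strainSpacePerp τ p ∧ ∫ ω, w ω ∂P = Aeff τ p A ξ} :=
    ⟨fun v hv => pairing_totalStrain_eq_zero hτ hA ξ (mem_strainSubmodule.2 hv),
      (Aeff_eq_integral_nemytskii hA ξ).symm⟩
  refine (csInf_le ⟨0, ?_⟩ (Set.mem_image_of_mem _ hmem)).trans
    (VarLp.integral_rpow_div_le_modular _)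
  · rintro _ ⟨w, -, rfl⟩
    refine integral_nonneg fun ω => ?_
    have := p.conj.pos ω
    positivity

theorem exists_conjEnergy_Aeff_le (hτ : ∀ y, MeasurePreserving (τ y) P P)
    (hA : IsAdmissible p A) :
    ∃ c₁ : ℝ, 0 < c₁ ∧ ∀ ξ, conjEnergy τ p (Aeff τ p A ξ) ≤ c₁ * minEnergy τ p ξ + c₁ := by
  obtain ⟨K, hK, hmod⟩ := exists_modular_totalStrain_le (τ := τ) hτ hA
  obtain ⟨c, hc, hgr⟩ := hA.exists_modular_nemytskii_le
  have hβ : 1 < p.β := p.one_lt_β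
  have hle : ∀ ξ, (totalStrain τ p A ξ).modular ≤ (K + 1) * (p.β * minEnergy τ p ξ + 1) := by
    intro ξ
    have h1 : ((totalStrain τ p A ξ).modular / (K + 1) - 1) / p.β ≤ minEnergy τ p ξ := by
      refine le_minEnergy hτ fun v hv => ?_
      rw [sub_le_iff_le_add, div_le_iff₀' (by positivity)]
      refine (hmod ξ v hv).trans ?_
      have := (VarLp.const ξ + v).modular_nonneg
      gcongr
      linarith
    rw [div_le_iff₀' (by linarith), sub_le_iff_le_add, div_le_iff₀' (by positivity)] at h1
    exact h1
  have hmin : ∀ ξ : SymMat d, 0 ≤ minEnergy τ p ξ := fun ξ => by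
    simpa using le_minEnergy (c := 0) (ξ := ξ) hτ fun v _ => VarLp.modular_nonneg _
  refine ⟨c * (K + 1) * p.β + c, by positivity, fun ξ => ?_⟩
  have h1 := (conjEnergy_Aeff_le hτ hA ξ).trans (hgr _)
  have h2 : c * (totalStrain τ p A ξ).modular ≤ c * ((K + 1) * (p.β * minEnergy τ p ξ + 1)) := by
    gcongr
    exact hle ξ
  have h3 : c * (K + 1) ≤ c * (K + 1) * p.β := le_mul_of_one_le_right (by positivity) hβ.le
  have h4 : 0 ≤ c * minEnergy τ p ξ := mul_nonneg hc.le (hmin ξ)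
  nlinarith

end CellProblem

/-! ### The homogenized tensor -/

theorem mainTheorem3 {Ω : Type*} [MetricSpace Ω] [CompactSpace Ω] [MeasurableSpace Ω]
    [BorelSpace Ω] (P : Measure Ω) [IsProbabilityMeasure P] (d : ℕ)
    (τ : EuclideanSpace ℝ (Fin d) → Ω → Ω) (hτ : IsErgodicDynamicalSystem P τ)
    (p : VariableExponent P) (A : Ω → SymMat d → SymMat d) (hA : IsAdmissible p A) :
    -- the cell problem is uniquely solvable, so that `v_ξ` and `A^eff` are well defined
    (∀ ξ, ∃! v, IsCellSolution τ p A ξ v) ∧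
    -- strict monotonicity
    (∀ ξ₁ ξ₂, ξ₁ ≠ ξ₂ → 0 < inner ℝ (Aeff τ p A ξ₁ - Aeff τ p A ξ₂) (ξ₁ - ξ₂)) ∧
    -- continuity
    Continuous (Aeff τ p A) ∧
    -- the flux is in `L^{p'(·)}` and is weakly continuous in `ξ`
    (∃ J : SymMat d → VarLp (SymMat d) p.conj,
      (∀ ξ, ∀ᵐ ω ∂P, J ξ ω = flux τ p A ξ ω) ∧
      Continuous fun ξ => toWeakSpace ℝ (VarLp (SymMat d) p.conj) (J ξ)) ∧
    -- growth bounds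
    (∃ c₀ : ℝ, 0 < c₀ ∧ ∀ ξ, c₀ * minEnergy τ p ξ - c₀⁻¹ ≤ inner ℝ (Aeff τ p A ξ) ξ) ∧
    (∃ c₁ : ℝ, 0 < c₁ ∧ ∀ ξ, conjEnergy τ p (Aeff τ p A ξ) ≤ c₁ * minEnergy τ p ξ + c₁) := by
  have hmp := hτ.measurePreserving
  exact ⟨existsUnique_isCellSolution hmp hA, fun _ _ h => inner_Aeff_sub_pos hmp hA h,
    continuous_Aeff hmp hA,
    ⟨fun ξ => hA.nemytskii (totalStrain τ p A ξ), ae_nemytskii_totalStrain hA,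
      (toWeakSpaceCLM ℝ _).continuous.comp (continuous_nemytskii_totalStrain hmp hA)⟩,
    exists_minEnergy_le_inner_Aeff hmp hA, exists_conjEnergy_Aeff_le hmp hA⟩
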